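/- Let $d,m\in\mathbb N$, $r>0$, $T>0$, $\beta>0$ and $0<\alpha<\min\{\tfrac12,\beta\}$; $|\cdot|$ denotes Euclidean norms, and $\mathbb R^d_+=\{u\in\mathbb R^d: u_i\ge 0,\ i=1,\dots,d\}$. For measurable $f:[s,t]\to\mathbb R^d$ put $$\|f\|_{\alpha,\infty(s,t)}=\sup_{u\in[s,t]}\Bigl(|f(u)|+\int_s^u\frac{|f(u)-f(v)|}{(u-v)^{\alpha+1}}\,dv\Bigr),$$ and let $W_0^{\alpha,\infty}(s,t)$ be the set of those $f$ for which this is finite. For $0<\lambda\le1$ put $$\|f\|_{\lambda(s,t)}=\sup_{u\in[s,t]}|f(u)|+\sup_{s\le u<v\le t}\frac{|f(v)-f(u)|}{(v-u)^\lambda},$$ and let $C^\lambda(s,t;\mathbb R^d)$ be the space of $\lambda$-Hölder continuous functions on $[s,t]$, normed by $\|\cdot\|_{\lambda(s,t)}$. Let $W_T^{1-\alpha,\infty}(0,T;\mathbb R^m)$ be the set of measurable $g:[0,T]\to\mathbb R^m$ with $$\sup_{0<s<t<T}\Bigl(\frac{|g(t)-g(s)|}{(t-s)^{1-\alpha}}+\int_s^t\frac{|g(y)-g(s)|}{(y-s)^{2-\alpha}}\,dy\Bigr)<\infty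 .$$ Put $g_{t-}(s)=(g(s)-g(t-))\mathbf 1_{(0,t)}(s)$, $$D^{\alpha}_{0+}f(s)=\frac1{\Gamma(1-\alpha)}\Bigl(\frac{f(s)}{s^\alpha}+\alpha\int_0^s\frac{f(s)-f(y)}{(s-y)^{\alpha+1}}\,dy\Bigr),$$ $$D^{1-\alpha}_{t-}g_{t-}(s)=\frac{(-1)^{1-\alpha}}{\Gamma(\alpha)}\Bigl(\frac{g_{t-}(s)}{(t-s)^{1-\alpha}}+(1-\alpha)\int_s^t\frac{g_{t-}(s)-g_{t-}(y)}{(y-s)^{2-\alpha}}\,dy\Bigr),$$ where $(-1)^a=e^{i\pi a}$, and $$\Lambda_\alpha(g)=\frac1{\Gamma(1-\alpha)}\sup_{0<s<t<T}\bigl|(D^{1-\alpha}_{t-}g_{t-})(s)\bigr|.$$ For scalar $f,g$ put $\int_0^T f\,dg=(-1)^\alpha\int_0^T D^\alpha_{0+}f(s)\,D^{1-\alpha}_{T-}g_{T-}(s)\,ds$ and $\int_0^t f\,dg=\int_0^T f\,\mathbf 1_{(0,t)}\,dg$. For matrix-valued $f$ and vector-valued $g$, the integral is $\bigl(\int_0^t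 f\,dg\bigr)^i=\sum_j\int_0^t f^{ij}\,dg^j$. Assume the following. (H1) $\sigma:[0,T]\times\mathbb R^d\to\mathbb R^{d\times m}$ is measurable, and for some $M_0>0$, for all $x,y\in\mathbb R^d$ and $s,t\in[0,T]$: $|\sigma(t,x)-\sigma(t,y)|\le M_0|x-y|$ and $|\sigma(t,x)-\sigma(s,x)|\le M_0|t-s|^\beta$. (H2) $b:[0,T]\times C([-r,T];\mathbb R^d)\to\mathbb R^d$ is measurable, where $C([-r,T];\mathbb R^d)$ carries the supremum norm $\|\cdot\|_\infty$ and its Borel $\sigma$-algebra. For every $t\in(0,T]$, $b(t,f)$ depends only on $f|_{[-r,t]}$. There are a real function $b_0$ on $[0,T]$ with $b_0\in L^{1/\alpha}(0,T)$ and constants $L_N>0$ ($N\ge0$) such that, for all $t\in[0,T]$ and all $x,y\in C([-r,T];\mathbb R^d)$, $$|b(t,x)-b(t,y)|\le L_N\sup_{-r\le s\le t}|x(s)-y(s)|\quad\text{whenever }\|x\|_\infty,\|y\|_\infty\le N,$$ $$|b(t,x)|\le L_0\sup_{-r\le s\le t}|x(s)|+b_0(t).$$ Then there is a constant $d^{(6)}>0$,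 depending on $d,m,r,T,\alpha,\beta,\sigma,b$ but not on $g$, $\eta$ or $x$, such that the following holds. Let $g\in W_T^{1-\alpha,\infty}(0,T;\mathbb R^m)$, let $\eta\in W_0^{\alpha,\infty}(-r,0)$ take values in $\mathbb R^d_+$, and let $x\in W_0^{\alpha,\infty}(-r,T)$, continuous on $[-r,T]$ with values in $\mathbb R^d_+$, be a solution of $$x(t)=z(t)+y(t),\quad t\in(0,T],\qquad x(t)=\eta(t),\quad t\in[-r,0],$$ where, for $t\in[0,T]$ and $i=1,\dots,d$, $$z(t)=\eta(0)+\int_0^t b(s,x)\,ds+\int_0^t\sigma(s,x(s-r))\,dg_s,\qquad y^i(t)=\max_{s\in[0,t]}(z^i(s))^- .$$ Then $x\in C^{1-\alpha}(0,T;\mathbb R^d)$ and $$\|x\|_{1-\alpha(0,T)}\le d^{(6)}\bigl(1+\Lambda_\alpha(g)\bigr)\bigl(1+\|x\|_{\alpha,\infty(-r,T)}\bigr).$$ -/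

import Mathlib

open Set MeasureTheory
open scoped ENNReal

namespace ReflectedDelay

noncomputable section

/-- `ℝⁿ` with its Euclidean norm. -/
abbrev Vec (n : ℕ) : Type := EuclideanSpace ℝ (Fin n)

/-- Real `d × m` matrices with the Euclidean (Frobenius) norm. -/
abbrev Mat (d m : ℕ) : Type := EuclideanSpace ℝ (Fin d × Fin m)

/-- The path space `C(-r,T;ℝᵈ)`, with the supremum norm. -/
abbrev PathSpace (d : ℕ) (r T : ℝ) : Type := C(Icc (-r) T, Vec d)

section Norms

variable {E : Type*} [NormedAddCommGroup E]

/-- `‖f‖_{α,∞(s,t)} = sup_{u ∈ [s,t]} ( |f(u)| + ∫_s^u |f(u) - f(v)| / (u - v)^{α+1} dv )`,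
as an extended nonnegative real. -/
def wNorm (α s t : ℝ) (f : ℝ → E) : ℝ≥0∞ :=
  ⨆ u ∈ Icc s t,
    (‖f u‖ₑ + ∫⁻ v in Ioo s u, ‖f u - f v‖ₑ / ENNReal.ofReal ((u - v) ^ (α + 1)))

/-- `f ∈ W_0^{α,∞}(s,t)`; only the values of `f` on `[s,t]` matter. -/
def MemW [MeasurableSpace E] (α s t : ℝ) (f : ℝ → E) : Prop :=
  Measurable ((Icc s t).domRestrict f) ∧ wNorm α s t f < ∞

/-- `‖f‖_{lam(s,t)} = sup_{u ∈ [s,t]} |f(u)| + sup_{s ≤ u < v ≤ t} |f(v) - f(u)| / (v - u)^lam`,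
as an extended nonnegative real. -/
def holderNorm (lam s t : ℝ) (f : ℝ → E) : ℝ≥0∞ :=
  (⨆ u ∈ Icc s t, ‖f u‖ₑ) +
    ⨆ (u : ℝ) (v : ℝ) (_ : s ≤ u ∧ u < v ∧ v ≤ t),
      ‖f v - f u‖ₑ / ENNReal.ofReal ((v - u) ^ lam)

/-- `f ∈ C^lam(s,t)`: `f` is `lam`-Hölder continuous on `[s,t]`. -/
def MemHolderOn (lam s t : ℝ) (f : ℝ → E) : Prop :=
  ContinuousOn f (Icc s t) ∧ holderNorm lam s t f < ∞

/-- `‖g‖_{1-α,∞,T} = sup_{0<s<t<T} ( |g(t) - g(s)| / (t - s)^{1-α}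
  + ∫_s^t |g(y) - g(s)| / (y - s)^{2-α} dy )`, as an extended nonnegative real. -/
def driverNorm (α T : ℝ) (g : ℝ → E) : ℝ≥0∞ :=
  ⨆ (s : ℝ) (t : ℝ) (_ : 0 < s ∧ s < t ∧ t < T),
    (‖g t - g s‖ₑ / ENNReal.ofReal ((t - s) ^ (1 - α)) +
      ∫⁻ y in Ioo s t, ‖g y - g s‖ₑ / ENNReal.ofReal ((y - s) ^ (2 - α)))

/-- `g ∈ W_T^{1-α,∞}(0,T)`. -/
def MemDriver [MeasurableSpace E] (α T : ℝ) (g : ℝ → E) : Prop :=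
  Measurable ((Icc 0 T).domRestrict g) ∧ driverNorm α T g < ∞

end Norms

section FractionalCalculus

/-- The left-sided Weyl derivative
`(D^a_{0+} f)(s) = Γ(1-a)⁻¹ ( f(s) / s^a + a ∫_0^s (f(s) - f(y)) / (s - y)^{a+1} dy )`. -/
def weylLeft (a : ℝ) (f : ℝ → ℝ) (s : ℝ) : ℝ :=
  (Real.Gamma (1 - a))⁻¹ *
    (f s / s ^ a + a * ∫ y in (0 : ℝ)..s, (f s - f y) / (s - y) ^ (a + 1))

variable {E : Type*} [NormedAddCommGroup E] [NormedSpace ℝ E]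

/-- The right-sided Weyl derivative on `(0,t)` without its unimodular constant factor `(-1)^a`:
`Γ(1-a)⁻¹ ( h(s) / (t - s)^a + a ∫_s^t (h(s) - h(y)) / (y - s)^{a+1} dy )`. -/
def weylRight (a t : ℝ) (h : ℝ → E) (s : ℝ) : E :=
  (Real.Gamma (1 - a))⁻¹ •
    (((t - s) ^ a)⁻¹ • h s + a • ∫ y in s..t, ((y - s) ^ (a + 1))⁻¹ • (h s - h y))

/-- `g_{t-}(s) = (g(s) - g(t-)) 1_{(0,t)}(s)`. -/
def leftShift (g : ℝ → E) (t : ℝ) : ℝ → E :=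
  (Ioo 0 t).indicator fun s => g s - Function.leftLim g t

/-- `Λ_α(g) = Γ(1-α)⁻¹ sup_{0<s<t<T} |(D^{1-α}_{t-} g_{t-})(s)|`, as an extended nonnegative
real. -/
def Lam (α T : ℝ) (g : ℝ → E) : ℝ≥0∞ :=
  ENNReal.ofReal (Real.Gamma (1 - α))⁻¹ *
    ⨆ (s : ℝ) (t : ℝ) (_ : 0 < s ∧ s < t ∧ t < T),
      ‖weylRight (1 - α) t (leftShift g t) s‖ₑ

/-- The generalized (fractional) Stieltjes integral
`∫_0^T f dg = (-1)^α ∫_0^T (D^α_{0+} f)(s) (D^{1-α}_{T-} g_{T-})(s) ds`.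
The sign is `(-1)^α (-1)^{1-α} = -1`, the second factor being the one left out of `weylRight`. -/
def stieltjes (α T : ℝ) (f g : ℝ → ℝ) : ℝ :=
  -∫ s in (0 : ℝ)..T, weylLeft α f s * weylRight (1 - α) T (leftShift g T) s

/-- The indefinite integral `∫_0^t f dg = ∫_0^T f 1_{(0,t)} dg` of a matrix-valued `f` against a
vector-valued `g`. -/
def stieltjesTo {d m : ℕ} (α T : ℝ) (f : ℝ → Mat d m) (g : ℝ → Vec m) (t : ℝ) : Vec d :=
  WithLp.toLp 2 fun i =>
    ∑ j : Fin m, stieltjes α T ((Ioo 0 t).indicator fun s => f s (i, j)) (fun s => g s j)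

end FractionalCalculus

/-- The assumptions on the diffusion coefficient `σ : [0,T] × ℝᵈ → ℝ^{d×m}`. -/
structure DiffusionHyp {d m : ℕ} (T β : ℝ) (σ : ℝ → Vec d → Mat d m) : Prop where
  measurable : Measurable fun p : Icc (0 : ℝ) T × Vec d => σ p.1 p.2
  beta_pos : 0 < β
  bounds : ∃ M₀ : ℝ, 0 < M₀ ∧
    (∀ x y : Vec d, ∀ t ∈ Icc 0 T, ‖σ t x - σ t y‖ ≤ M₀ * ‖x - y‖) ∧
    (∀ x : Vec d, ∀ t ∈ Icc 0 T, ∀ s ∈ Icc 0 T, ‖σ t x - σ s x‖ ≤ M₀ * |t - s| ^ β)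

/-- `sup_{-r ≤ s ≤ t} |f(s)|` for `t ∈ [0,T]`. -/
def pastSup {d : ℕ} {r T : ℝ} (t : ℝ) (f : PathSpace d r T) : ℝ :=
  ⨆ s : {s : Icc (-r) T // (s : ℝ) ≤ t}, ‖f s.1‖

/-- The assumptions on the hereditary drift `b : [0,T] × C(-r,T;ℝᵈ) → ℝᵈ`, the path space carrying
its Borel `σ`-algebra. -/
structure DriftHyp {d : ℕ} (r T ρ : ℝ) (b : ℝ → PathSpace d r T → Vec d) : Prop where
  measurable :
    letI : MeasurableSpace (PathSpace d r T) := borel (PathSpace d r T)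
    Measurable fun p : Icc (0 : ℝ) T × PathSpace d r T => b p.1 p.2
  adapted : ∀ t ∈ Ioc 0 T, ∀ f h : PathSpace d r T,
    (∀ s : Icc (-r) T, (s : ℝ) ≤ t → f s = h s) → b t f = b t h
  two_le : 2 ≤ ρ
  bounds : ∃ (b₀ : ℝ → ℝ) (L : ℝ → ℝ),
    MemLp b₀ (ENNReal.ofReal ρ) (volume.restrict (Ioo 0 T)) ∧
    (∀ N, 0 ≤ N → 0 < L N) ∧
    (∀ N, 0 ≤ N → ∀ x y : PathSpace d r T, ‖x‖ ≤ N → ‖y‖ ≤ N → ∀ t ∈ Icc 0 T,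
      ‖b t x - b t y‖ ≤ L N * pastSup t (x - y)) ∧
    (∀ x : PathSpace d r T, ∀ t ∈ Icc 0 T, ‖b t x‖ ≤ L 0 * pastSup t x + b₀ t)

/-- `x` is a solution, in `W_0^{α,∞}(-r,T;ℝᵈ₊)`, of the reflected delay equation with initial path
`η` and driver `g`. It is continuous, so that `b(s,x)` is meaningful. The functions `z` and `y` are
the reflector and the regulator, `yⁱ(t) = max_{s ∈ [0,t]} (zⁱ(s))⁻`. -/
structure IsSolution {d m : ℕ} (r T α : ℝ) (b : ℝ → PathSpace d r T → Vec d)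
    (σ : ℝ → Vec d → Mat d m) (η : ℝ → Vec d) (g : ℝ → Vec m) (x : ℝ → Vec d) : Prop where
  cont : ContinuousOn x (Icc (-r) T)
  memW : MemW α (-r) T x
  nonneg : ∀ t ∈ Icc (-r) T, ∀ i, 0 ≤ x t i
  initial : ∀ t ∈ Icc (-r) 0, x t = η t
  equation : ∃ z y : ℝ → Vec d,
    (∀ t ∈ Icc 0 T, z t = η 0 + (∫ s in (0 : ℝ)..t, b s ⟨(Icc (-r) T).domRestrict x, cont.domRestrict⟩)
      + stieltjesTo α T (fun s => σ s (x (s - r))) g t) ∧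
    (∀ t ∈ Icc 0 T, ∀ i, IsGreatest ((fun s => max (-(z s i)) 0) '' Icc 0 t) (y t i)) ∧
    (∀ t ∈ Ioc 0 T, x t = z t + y t)

end

end ReflectedDelay

open ReflectedDelay

namespace ReflectedDelay

open Filter Topology

/-! Write `N` for `wNorm α (-r) T x` and `Λ` for `Lam α T g`. It suffices to show that `z` is
`(1-α)`-Hölder with a constant of order `(1 + Λ)(1 + N)`. The regulator is a running maximum, so it
inherits this modulus coordinatewise, and so does `x = z + y`; the sup norm of `x` is at most `N`.

The drift part of `z` is Hölder's inequality: `b₀ ∈ L^{1/α}` contributes `(t-s)^{1-α}`, and the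
linear growth term contributes a multiple of `N (t-s)`, which is absorbed since `t - s ≤ T`.

For the fractional integral, the increment from `s` to `t` is the integral over `(0,T)` of the
difference of the left Weyl derivatives of two cut-offs of one integrand, against a right Weyl
derivative bounded by a multiple of `Λ`. This difference vanishes before `s`, is at most of order
`(u-s)^{-α} + α` on `(s,t)`, and of order `(u-t)^{-α} - (u-s)^{-α}` after `t`. Each bound integrates
to a multiple of `(t-s)^{1-α}` (`FracBounded.abs_stieltjes_sub_le`).

Two further facts are needed. The supremum in `Λ` runs over `t < T` while the integral uses the
terminal time `T`, which is reached by a limit (`MemDriver.norm_weylRight_terminal_le`). The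
integrand `σ(u, x(u-r))` must have sup norm and fractional increments of order `1 + N`
(`diffusion_fracBounded`), which uses `α < β`. -/

/-- A continuous scalar integrand on `[0,T]` whose sup norm and fractional increments are
bounded by `K`. -/
structure FracBounded (α T K : ℝ) (φ : ℝ → ℝ) : Prop where
  cont : ContinuousOn φ (Icc 0 T)
  bound : ∀ u ∈ Icc 0 T, |φ u| ≤ K
  increments : ∀ u ∈ Icc 0 T,
    ∫⁻ v in Ioo 0 u, ‖φ u - φ v‖ₑ / ENNReal.ofReal ((u - v) ^ (α + 1)) ≤ ENNReal.ofReal K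

/-! ### Elementary measurability and power integrals. -/

theorem enorm_div_ofReal {a b : ℝ} (hb : 0 < b) : ‖a‖ₑ / ENNReal.ofReal b = ‖a / b‖ₑ := by
  rw [Real.enorm_eq_ofReal_abs, Real.enorm_eq_ofReal_abs, abs_div, abs_of_pos hb,
    ENNReal.ofReal_div_of_pos hb]

theorem measurable_indicator_of_continuousOn {E : Type*} [TopologicalSpace E] [MeasurableSpace E]
    [BorelSpace E] [Zero E] {f : ℝ → E} {s : Set ℝ} (hs : MeasurableSet s)
    (hf : ContinuousOn f s) : Measurable (s.indicator f) := by
  classical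
  rw [← Set.piecewise_eq_indicator]
  exact hf.measurable_piecewise continuousOn_const hs

/-- The antiderivative of the Weyl kernel is `(u - y)^(-α) / α`. With `a = 0`, the term at `a` is
what later cancels the boundary term `φ u / u ^ α`. -/
theorem integral_kernel {α a b u : ℝ} (hab : a ≤ b) (hbu : b < u) :
    IntervalIntegrable (fun y => ((u - y) ^ (α + 1))⁻¹) volume a b ∧
    α * ∫ y in a..b, ((u - y) ^ (α + 1))⁻¹ = (u - b) ^ (-α) - (u - a) ^ (-α) := by
  have hder : ∀ y ∈ uIcc a b, HasDerivAt (fun y => (u - y) ^ (-α))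
      (α * ((u - y) ^ (α + 1))⁻¹) y := by
    intro y hy
    rw [uIcc_of_le hab] at hy
    have hpos : 0 < u - y := by linarith [hy.2]
    have h := ((hasDerivAt_id y).const_sub u).rpow_const (p := -α) (Or.inl hpos.ne')
    simp only [id] at h
    convert h using 1
    rw [← Real.rpow_neg hpos.le]
    rw [show -α - 1 = -(α + 1) by ring]
    ring
  have hcont : ContinuousOn (fun y => ((u - y) ^ (α + 1))⁻¹) (uIcc a b) := by
    intro y hy
    rw [uIcc_of_le hab] at hy
    have hpos : 0 < u - y := by linarith [hy.2]
    refine ContinuousAt.continuousWithinAt ?_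
    refine ContinuousAt.inv₀ ?_ (Real.rpow_pos_of_pos hpos _).ne'
    exact ContinuousAt.rpow_const (by fun_prop) (Or.inl hpos.ne')
  have hint := hcont.intervalIntegrable (μ := volume)
  refine ⟨hint, ?_⟩
  rw [← intervalIntegral.integral_const_mul]
  exact intervalIntegral.integral_eq_sub_of_hasDerivAt hder (hint.const_mul α)

theorem integral_sub_rpow {α a b c : ℝ} (hα1 : α < 1) :
    IntervalIntegrable (fun u => (u - c) ^ (-α)) volume a b ∧
    ∫ u in a..b, (u - c) ^ (-α) = ((b - c) ^ (1 - α) - (a - c) ^ (1 - α)) / (1 - α) := by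
  have hr : -1 < -α := by linarith
  constructor
  · have h := (intervalIntegral.intervalIntegrable_rpow' (a := a - c) (b := b - c) hr)
    simpa using h.comp_sub_right c
  · rw [intervalIntegral.integral_comp_sub_right (fun u => u ^ (-α)) c,
      integral_rpow (Or.inl hr)]
    ring_nf

/-! ### Left Weyl derivatives of cut-off integrands. -/

namespace FracBounded

variable {α T K : ℝ} {φ : ℝ → ℝ}

theorem nonneg (h : FracBounded α T K φ) (hT : 0 ≤ T) : 0 ≤ K :=
  (abs_nonneg _).trans (h.bound 0 ⟨le_rfl, hT⟩)

theorem measurable_cut (h : FracBounded α T K φ) {t : ℝ} (ht : t ≤ T) :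
    Measurable ((Ioo 0 t).indicator φ) :=
  measurable_indicator_of_continuousOn measurableSet_Ioo
    (h.cont.mono fun _ hx => ⟨hx.1.le, hx.2.le.trans ht⟩)

theorem abs_cut_le (h : FracBounded α T K φ) {t : ℝ} (hT : 0 ≤ T) (ht : t ≤ T) (u : ℝ) :
    |(Ioo 0 t).indicator φ u| ≤ K := by
  by_cases hu : u ∈ Ioo 0 t
  · rw [indicator_of_mem hu]
    exact h.bound u ⟨hu.1.le, hu.2.le.trans ht⟩
  · rw [indicator_of_notMem hu, abs_zero]
    exact h.nonneg hT

theorem lintegral_increment (h : FracBounded α T K φ) {u : ℝ} (hu : u ∈ Icc 0 T) :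
    ∫⁻ v in Ioo 0 u, ‖(φ u - φ v) / (u - v) ^ (α + 1)‖ₑ ≤ ENNReal.ofReal K := by
  refine le_trans (le_of_eq ?_) (h.increments u hu)
  refine setLIntegral_congr_fun measurableSet_Ioo fun v hv => ?_
  exact (enorm_div_ofReal (Real.rpow_pos_of_pos (by linarith [hv.2]) _)).symm

theorem integrableOn_increment (h : FracBounded α T K φ) {u : ℝ} (hu : u ∈ Icc 0 T) :
    IntegrableOn (fun v => (φ u - φ v) / (u - v) ^ (α + 1)) (Ioo 0 u) := by
  refine ⟨?_, (h.lintegral_increment hu).trans_lt ENNReal.ofReal_lt_top⟩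
  have h1 : AEStronglyMeasurable φ (volume.restrict (Ioo 0 u)) :=
    (h.cont.mono fun _ hx => ⟨hx.1.le, hx.2.le.trans hu.2⟩).aestronglyMeasurable
      measurableSet_Ioo
  have h2 : Measurable fun v : ℝ => (u - v) ^ (α + 1) := by fun_prop
  simp only [div_eq_mul_inv]
  exact (aestronglyMeasurable_const.sub h1).mul h2.inv.aestronglyMeasurable

theorem abs_integral_increment_le (h : FracBounded α T K φ) {s u : ℝ} (hT : 0 ≤ T) (hs : 0 ≤ s)
    (hsu : s ≤ u) (hu : u ≤ T) : |∫ v in s..u, (φ u - φ v) / (u - v) ^ (α + 1)| ≤ K := by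
  rw [intervalIntegral.integral_of_le hsu, integral_Ioc_eq_integral_Ioo, ← Real.norm_eq_abs]
  have h1 := enorm_integral_le_lintegral_enorm (μ := volume.restrict (Ioo s u))
    (fun v => (φ u - φ v) / (u - v) ^ (α + 1))
  have h2 : ∫⁻ v in Ioo s u, ‖(φ u - φ v) / (u - v) ^ (α + 1)‖ₑ ≤ ENNReal.ofReal K :=
    (lintegral_mono_set (Ioo_subset_Ioo_left hs)).trans
      (h.lintegral_increment ⟨hs.trans hsu, hu⟩)
  have h3 := h1.trans h2
  rw [← ofReal_norm] at h3
  exact (ENNReal.ofReal_le_ofReal_iff (h.nonneg hT)).1 h3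

/-- For `u < t` the cut-off is invisible and the increments of `φ` are integrable. For `u > t` the
numerator vanishes unless `y < t`, so the singularity at `y = u` is never met and `K / (u -
t)^(α+1)` is a bound. -/
theorem intervalIntegrable_cut (h : FracBounded α T K φ) {t u : ℝ} (hα : 0 < α)
    (ht : t ≤ T) (hu : u ∈ Ioo 0 T) (hut : u ≠ t) :
    IntervalIntegrable (fun y => ((Ioo 0 t).indicator φ u - (Ioo 0 t).indicator φ y) /
      (u - y) ^ (α + 1)) volume 0 u := by
  rw [intervalIntegrable_iff_integrableOn_Ioo_of_le hu.1.le]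
  rcases lt_or_gt_of_ne hut with hlt | hgt
  · refine (h.integrableOn_increment ⟨hu.1.le, hu.2.le⟩).congr_fun (fun y hy => ?_)
      measurableSet_Ioo
    rw [indicator_of_mem (show u ∈ Ioo 0 t from ⟨hu.1, hlt⟩),
      indicator_of_mem (show y ∈ Ioo 0 t from ⟨hy.1, hy.2.trans hlt⟩)]
  · have hm : Measurable (fun y => ((Ioo 0 t).indicator φ u - (Ioo 0 t).indicator φ y) /
        (u - y) ^ (α + 1)) :=
      ((measurable_const.sub (h.measurable_cut ht)).div (by fun_prop))
    refine Measure.integrableOn_of_bounded (M := K / (u - t) ^ (α + 1)) (by simp)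
      hm.aestronglyMeasurable ?_
    rw [ae_restrict_iff' measurableSet_Ioo]
    refine ae_of_all _ fun y hy => ?_
    have hK := h.nonneg (hu.1.le.trans hu.2.le)
    have hp : 0 < (u - t) ^ (α + 1) := Real.rpow_pos_of_pos (by linarith) _
    rw [indicator_of_notMem (show u ∉ Ioo 0 t from fun h => absurd h.2 (not_lt.2 hgt.le))]
    by_cases hyt : y ∈ Ioo 0 t
    · have hp' : (u - t) ^ (α + 1) ≤ (u - y) ^ (α + 1) :=
        Real.rpow_le_rpow (by linarith) (by linarith [hyt.2]) (by linarith)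
      rw [Real.norm_eq_abs, abs_div, zero_sub, abs_neg, abs_of_pos (hp.trans_le hp')]
      exact div_le_div₀ hK (h.abs_cut_le (hu.1.le.trans hu.2.le) ht y) hp hp'
    · rw [indicator_of_notMem hyt]
      simp only [sub_zero, zero_div, norm_zero]
      positivity

theorem gamma_inv_nonneg {α : ℝ} (hα1 : α < 1) : 0 ≤ (Real.Gamma (1 - α))⁻¹ :=
  inv_nonneg.2 (Real.Gamma_pos_of_pos (by linarith)).le

/-- Subtracting the left Weyl derivatives of two cut-offs. -/
theorem weylLeft_cut_sub (h : FracBounded α T K φ) {s t u : ℝ} (hα : 0 < α)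
    (hst : s ≤ t) (ht : t ≤ T) (hu : u ∈ Ioo 0 T) (hus : u ≠ s) (hut : u ≠ t) :
    weylLeft α ((Ioo 0 t).indicator φ) u - weylLeft α ((Ioo 0 s).indicator φ) u =
      (Real.Gamma (1 - α))⁻¹ *
        (((Ioo 0 t).indicator φ u - (Ioo 0 s).indicator φ u) / u ^ α +
          α * ∫ y in (0 : ℝ)..u, (((Ioo 0 t).indicator φ u - (Ioo 0 t).indicator φ y) /
            (u - y) ^ (α + 1) - ((Ioo 0 s).indicator φ u - (Ioo 0 s).indicator φ y) /
            (u - y) ^ (α + 1))) := by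
  rw [intervalIntegral.integral_sub (h.intervalIntegrable_cut hα ht hu hut)
    (h.intervalIntegrable_cut hα (hst.trans ht) hu hus)]
  unfold weylLeft
  ring

theorem weylLeft_cut_sub_of_lt (φ : ℝ → ℝ) {α s t u : ℝ} (hu : u ∈ Ioo 0 s) (hst : s ≤ t) :
    weylLeft α ((Ioo 0 t).indicator φ) u - weylLeft α ((Ioo 0 s).indicator φ) u = 0 := by
  have h0 : ∀ y ∈ Ioc 0 u, (Ioo 0 t).indicator φ y = (Ioo 0 s).indicator φ y := by
    intro y hy
    have hys : y < s := hy.2.trans_lt hu.2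
    rw [indicator_of_mem (show y ∈ Ioo 0 t from ⟨hy.1, hys.trans_le hst⟩),
      indicator_of_mem (show y ∈ Ioo 0 s from ⟨hy.1, hys⟩)]
  have h1 : ∫ y in (0 : ℝ)..u, ((Ioo 0 t).indicator φ u - (Ioo 0 t).indicator φ y) /
      (u - y) ^ (α + 1) = ∫ y in (0 : ℝ)..u, ((Ioo 0 s).indicator φ u -
      (Ioo 0 s).indicator φ y) / (u - y) ^ (α + 1) := by
    rw [intervalIntegral.integral_of_le hu.1.le, intervalIntegral.integral_of_le hu.1.le]
    refine setIntegral_congr_fun measurableSet_Ioc fun y hy => ?_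
    simp only [h0 y hy, h0 u ⟨hu.1, le_rfl⟩]
  unfold weylLeft
  rw [h1, h0 u ⟨hu.1, le_rfl⟩, sub_self]

/-- At such `u` only the longer cut-off is nonzero. Over `(0,s)` the integrands differ by `φ u`
times the kernel, and the exact integral cancels the boundary term, leaving `φ u * (u - s)^(-α)`.
Over `(s,u)` the ordinary increments of `φ` remain. -/
theorem abs_weylLeft_cut_sub_le_of_mem (h : FracBounded α T K φ) {s t u : ℝ} (hα : 0 < α)
    (hα1 : α < 1) (hs : 0 ≤ s) (ht : t ≤ T) (hu : u ∈ Ioo s t) :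
    |weylLeft α ((Ioo 0 t).indicator φ) u - weylLeft α ((Ioo 0 s).indicator φ) u| ≤
      (Real.Gamma (1 - α))⁻¹ * (K * ((u - s) ^ (-α) + α)) := by
  have hu0 : 0 < u := hs.trans_lt hu.1
  have huT : u ∈ Ioo 0 T := ⟨hu0, hu.2.trans_le ht⟩
  have hT : 0 ≤ T := hu0.le.trans huT.2.le
  have hst : s ≤ t := (hu.1.trans hu.2).le
  rw [h.weylLeft_cut_sub hα hst ht huT hu.1.ne' hu.2.ne, abs_mul,
    abs_of_nonneg (gamma_inv_nonneg hα1)]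
  refine mul_le_mul_of_nonneg_left ?_ (gamma_inv_nonneg hα1)
  have hint := (h.intervalIntegrable_cut hα ht huT hu.2.ne).sub
    (h.intervalIntegrable_cut hα (hst.trans ht) huT hu.1.ne')
  have hsub1 : uIcc 0 s ⊆ uIcc 0 u := by
    rw [uIcc_of_le hs, uIcc_of_le hu0.le]; exact Icc_subset_Icc_right hu.1.le
  have hsub2 : uIcc s u ⊆ uIcc 0 u := by
    rw [uIcc_of_le hu.1.le, uIcc_of_le hu0.le]; exact Icc_subset_Icc_left hs
  rw [← intervalIntegral.integral_add_adjacent_intervals (hint.mono_set hsub1)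
    (hint.mono_set hsub2)]
  have hut : u ∈ Ioo 0 t := ⟨hu0, hu.2⟩
  have hus : u ∉ Ioo 0 s := fun h => absurd h.2 (not_lt.2 hu.1.le)
  have e1 : ∫ y in (0 : ℝ)..s, (((Ioo 0 t).indicator φ u - (Ioo 0 t).indicator φ y) /
      (u - y) ^ (α + 1) - ((Ioo 0 s).indicator φ u - (Ioo 0 s).indicator φ y) /
      (u - y) ^ (α + 1)) = φ u * ∫ y in (0 : ℝ)..s, ((u - y) ^ (α + 1))⁻¹ := by
    rw [← intervalIntegral.integral_const_mul, intervalIntegral.integral_of_le hs,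
      intervalIntegral.integral_of_le hs, integral_Ioc_eq_integral_Ioo,
      integral_Ioc_eq_integral_Ioo]
    refine setIntegral_congr_fun measurableSet_Ioo fun y hy => ?_
    simp only [indicator_of_mem hut, indicator_of_notMem hus,
      indicator_of_mem (show y ∈ Ioo 0 t from ⟨hy.1, hy.2.trans_le hst⟩), indicator_of_mem hy]
    ring
  have e2 : ∫ y in s..u, (((Ioo 0 t).indicator φ u - (Ioo 0 t).indicator φ y) /
      (u - y) ^ (α + 1) - ((Ioo 0 s).indicator φ u - (Ioo 0 s).indicator φ y) /
      (u - y) ^ (α + 1)) = ∫ y in s..u, (φ u - φ y) / (u - y) ^ (α + 1) := by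
    rw [intervalIntegral.integral_of_le hu.1.le, intervalIntegral.integral_of_le hu.1.le,
      integral_Ioc_eq_integral_Ioo, integral_Ioc_eq_integral_Ioo]
    refine setIntegral_congr_fun measurableSet_Ioo fun y hy => ?_
    simp only [indicator_of_mem hut, indicator_of_notMem hus,
      indicator_of_mem (show y ∈ Ioo 0 t from ⟨hs.trans_lt hy.1, hy.2.trans hu.2⟩),
      indicator_of_notMem (show y ∉ Ioo 0 s from fun h => absurd h.2 (not_lt.2 hy.1.le))]
    ring
  rw [e1, e2, indicator_of_mem hut, indicator_of_notMem hus]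
  have hk := (integral_kernel (α := α) hs hu.1).2
  have hb := h.bound u ⟨hu0.le, huT.2.le⟩
  have hi := h.abs_integral_increment_le hT hs hu.1.le huT.2.le
  have e3 : (φ u - 0) / u ^ α + α * (φ u * (∫ y in (0 : ℝ)..s, ((u - y) ^ (α + 1))⁻¹) +
      ∫ y in s..u, (φ u - φ y) / (u - y) ^ (α + 1)) =
      φ u * (u - s) ^ (-α) + α * ∫ y in s..u, (φ u - φ y) / (u - y) ^ (α + 1) := by
    have : (u ^ α)⁻¹ = u ^ (-α) := (Real.rpow_neg hu0.le _).symm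
    rw [sub_zero, div_eq_mul_inv, this]
    rw [sub_zero] at hk
    linear_combination φ u * hk
  rw [e3]
  have hp : 0 ≤ (u - s) ^ (-α) := Real.rpow_nonneg (by linarith [hu.1]) _
  calc _ ≤ |φ u * (u - s) ^ (-α)| + |α * ∫ y in s..u, (φ u - φ y) / (u - y) ^ (α + 1)| :=
        abs_add_le _ _
    _ = |φ u| * (u - s) ^ (-α) + α * |∫ y in s..u, (φ u - φ y) / (u - y) ^ (α + 1)| := by
        rw [abs_mul, abs_mul, abs_of_nonneg hp, abs_of_pos hα]
    _ ≤ K * (u - s) ^ (-α) + α * K := by gcongr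
    _ = _ := by ring

/-- Both cut-offs vanish at `u`, so there is no boundary term, and the integrands differ only for
`y` between `s` and `t`, where `|φ| ≤ K`. -/
theorem abs_weylLeft_cut_sub_le_of_gt (h : FracBounded α T K φ) {s t u : ℝ} (hα : 0 < α)
    (hα1 : α < 1) (hs : 0 ≤ s) (hst : s ≤ t) (hu : u ∈ Ioo t T) :
    |weylLeft α ((Ioo 0 t).indicator φ) u - weylLeft α ((Ioo 0 s).indicator φ) u| ≤
      (Real.Gamma (1 - α))⁻¹ * (K * ((u - t) ^ (-α) - (u - s) ^ (-α))) := by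
  have ht0 : 0 ≤ t := hs.trans hst
  have hu0 : 0 < u := ht0.trans_lt hu.1
  have huT : u ∈ Ioo 0 T := ⟨hu0, hu.2⟩
  have hT : 0 ≤ T := hu0.le.trans huT.2.le
  have htT : t ≤ T := (hu.1.trans hu.2).le
  rw [h.weylLeft_cut_sub hα hst htT huT (hst.trans_lt hu.1).ne' hu.1.ne', abs_mul,
    abs_of_nonneg (gamma_inv_nonneg hα1)]
  refine mul_le_mul_of_nonneg_left ?_ (gamma_inv_nonneg hα1)
  have hut : u ∉ Ioo 0 t := fun h => absurd h.2 (not_lt.2 hu.1.le)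
  have hus : u ∉ Ioo 0 s := fun h => absurd h.2 (not_lt.2 (hst.trans hu.1.le))
  have e1 : ∫ y in (0 : ℝ)..u, (((Ioo 0 t).indicator φ u - (Ioo 0 t).indicator φ y) /
      (u - y) ^ (α + 1) - ((Ioo 0 s).indicator φ u - (Ioo 0 s).indicator φ y) /
      (u - y) ^ (α + 1)) = ∫ y in s..t, -φ y * ((u - y) ^ (α + 1))⁻¹ := by
    rw [intervalIntegral.integral_of_le hu0.le, intervalIntegral.integral_of_le hst,
      integral_Ioc_eq_integral_Ioo, integral_Ioc_eq_integral_Ioo]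
    rw [← integral_indicator measurableSet_Ioo, ← integral_indicator measurableSet_Ioo]
    refine integral_congr_ae ?_
    -- At `y = s` the open cut-offs and the indicator of `Ioo s t` disagree, so this null point is
    -- discarded.
    have hne : ∀ᵐ y : ℝ, y ≠ s := by simp [ae_iff, measure_singleton]
    filter_upwards [hne] with y hys
    have htu := hu.1
    simp only [indicator_of_notMem hut, indicator_of_notMem hus]
    simp only [indicator, mem_Ioo]
    split_ifs <;> first | (exfalso; grind) | ring1
  rw [e1, indicator_of_notMem hut, indicator_of_notMem hus]
  obtain ⟨hki, hk⟩ := integral_kernel (α := α) hst hu.1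
  have hb : |∫ y in s..t, -φ y * ((u - y) ^ (α + 1))⁻¹| ≤
      ∫ y in s..t, K * ((u - y) ^ (α + 1))⁻¹ := by
    rw [← Real.norm_eq_abs]
    refine intervalIntegral.norm_integral_le_of_norm_le hst (ae_of_all _ fun y hy => ?_)
      (hki.const_mul K)
    have hp : 0 ≤ ((u - y) ^ (α + 1))⁻¹ :=
      inv_nonneg.2 (Real.rpow_nonneg (by linarith [hy.2, hu.1]) _)
    rw [Real.norm_eq_abs, abs_mul, abs_neg, abs_of_nonneg hp]
    exact mul_le_mul_of_nonneg_right
      (h.bound y ⟨hs.trans hy.1.le, hy.2.trans htT⟩) hp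
  rw [intervalIntegral.integral_const_mul] at hb
  rw [sub_zero, zero_div, zero_add, abs_mul, abs_of_pos hα, ← hk]
  calc _ ≤ α * (K * ∫ y in s..t, ((u - y) ^ (α + 1))⁻¹) := by gcongr
    _ = _ := by ring

end FracBounded

/-! ### Increments of the scalar fractional integral. -/

theorem stronglyMeasurable_intervalIntegral {E : Type*} [NormedAddCommGroup E] [NormedSpace ℝ E]
    {k : ℝ → ℝ → E} (hk : StronglyMeasurable (Function.uncurry k)) {p q : ℝ → ℝ}
    (hp : Measurable p) (hq : Measurable q) :
    StronglyMeasurable fun s => ∫ y in p s..q s, k s y := by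
  have key : ∀ {p q : ℝ → ℝ}, Measurable p → Measurable q →
      StronglyMeasurable fun s => ∫ y in Ioc (p s) (q s), k s y := by
    intro p q hp hq
    have hS : MeasurableSet {z : ℝ × ℝ | z.2 ∈ Ioc (p z.1) (q z.1)} :=
      (measurableSet_lt (hp.comp measurable_fst) measurable_snd).inter
        (measurableSet_le measurable_snd (hq.comp measurable_fst))
    have h := StronglyMeasurable.integral_prod_right (ν := (volume : Measure ℝ))
      (f := fun s y => (Ioc (p s) (q s)).indicator (k s) y) (hk.indicator hS)
    simpa only [integral_indicator measurableSet_Ioc] using h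
  exact (key hp hq).sub (key hq hp)

theorem measurable_weylLeft {α : ℝ} {F : ℝ → ℝ} (hF : Measurable F) :
    Measurable (weylLeft α F) := by
  have hk : StronglyMeasurable (Function.uncurry fun s y : ℝ =>
      (F s - F y) / (s - y) ^ (α + 1)) := by
    refine Measurable.stronglyMeasurable ?_
    exact ((hF.comp measurable_fst).sub (hF.comp measurable_snd)).div
      ((measurable_fst.sub measurable_snd).pow_const _)
  have h := (stronglyMeasurable_intervalIntegral hk (measurable_const (a := (0 : ℝ)))
    measurable_id).measurable
  unfold weylLeft
  exact ((hF.div (measurable_id.pow_const α)).add (h.const_mul α)).const_mul _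

theorem intervalIntegrable_and_abs_integral_le {f maj : ℝ → ℝ} {a b : ℝ} (hab : a ≤ b)
    (hf : AEStronglyMeasurable f (volume.restrict (Ioo a b)))
    (hle : ∀ u ∈ Ioo a b, |f u| ≤ maj u) (hmaj : IntervalIntegrable maj volume a b) :
    IntervalIntegrable f volume a b ∧ |∫ u in a..b, f u| ≤ ∫ u in a..b, maj u := by
  have hae : ∀ᵐ u ∂volume.restrict (Ioo a b), ‖f u‖ ≤ maj u := by
    rw [ae_restrict_iff' measurableSet_Ioo]
    exact ae_of_all _ hle
  rw [intervalIntegrable_iff_integrableOn_Ioo_of_le hab] at hmaj ⊢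
  refine ⟨Integrable.mono' hmaj hf hae, ?_⟩
  rw [intervalIntegral.integral_of_le hab, intervalIntegral.integral_of_le hab,
    integral_Ioc_eq_integral_Ioo, integral_Ioc_eq_integral_Ioo]
  exact norm_integral_le_of_norm_le hmaj hae

/-- Converts bounds linear in the length of a time interval into `(1-α)`-Hölder bounds. -/
theorem le_rpow_mul_rpow {α a T : ℝ} (hα : 0 < α) (ha : 0 ≤ a) (haT : a ≤ T) :
    a ≤ T ^ α * a ^ (1 - α) := by
  rcases ha.eq_or_lt with rfl | hpos
  · exact mul_nonneg (Real.rpow_nonneg haT _) (Real.rpow_nonneg le_rfl _)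
  · calc a = a ^ α * a ^ (1 - α) := by rw [← Real.rpow_add hpos]; simp
      _ ≤ _ := by gcongr

/-- The constant of the increment estimate for the fractional integral. -/
noncomputable def stieltjesConst (α T : ℝ) : ℝ :=
  (Real.Gamma (1 - α))⁻¹ * (2 / (1 - α) + α * T ^ α)

theorem stieltjesConst_nonneg {α T : ℝ} (hα : 0 < α) (hα1 : α < 1) (hT : 0 ≤ T) :
    0 ≤ stieltjesConst α T := by
  have h1 : 0 < 1 - α := by linarith
  exact mul_nonneg (FracBounded.gamma_inv_nonneg hα1) (by positivity)

namespace FracBounded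

variable {α T K : ℝ} {φ : ℝ → ℝ}

theorem integral_weylLeft_cut_sub_mul (h : FracBounded α T K φ) {G : ℝ → ℝ} {M s t : ℝ}
    (hα : 0 < α) (hα1 : α < 1) (hs : 0 ≤ s) (hst : s ≤ t) (ht : t ≤ T)
    (hG : AEStronglyMeasurable G (volume.restrict (Ioo 0 T)))
    (hM0 : 0 ≤ M) (hM : ∀ u ∈ Ioo 0 T, |G u| ≤ M) :
    IntervalIntegrable (fun u => (weylLeft α ((Ioo 0 t).indicator φ) u -
        weylLeft α ((Ioo 0 s).indicator φ) u) * G u) volume 0 T ∧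
      |∫ u in (0 : ℝ)..T, (weylLeft α ((Ioo 0 t).indicator φ) u -
        weylLeft α ((Ioo 0 s).indicator φ) u) * G u| ≤
          stieltjesConst α T * K * M * (t - s) ^ (1 - α) := by
  set D : ℝ → ℝ := fun u => weylLeft α ((Ioo 0 t).indicator φ) u -
    weylLeft α ((Ioo 0 s).indicator φ) u with hD
  have hT : 0 ≤ T := (hs.trans hst).trans ht
  have hK := h.nonneg hT
  have hc := gamma_inv_nonneg hα1
  set c := (Real.Gamma (1 - α))⁻¹ with hcdef
  have h1α : 0 < 1 - α := by linarith
  have hDm : Measurable D := (measurable_weylLeft (h.measurable_cut ht)).sub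
    (measurable_weylLeft (h.measurable_cut (hst.trans ht)))
  have hm : AEStronglyMeasurable (fun u => D u * G u) (volume.restrict (Ioo 0 T)) :=
    hDm.aestronglyMeasurable.mul hG
  have hm' : ∀ {a b : ℝ}, 0 ≤ a → b ≤ T →
      AEStronglyMeasurable (fun u => D u * G u) (volume.restrict (Ioo a b)) := fun ha hb =>
    hm.mono_measure (Measure.restrict_mono (Ioo_subset_Ioo ha hb) le_rfl)
  have hDG : ∀ {u B : ℝ}, u ∈ Ioo 0 T → |D u| ≤ B → |D u * G u| ≤ B * M := by
    intro u B hu hB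
    rw [abs_mul]
    exact mul_le_mul hB (hM u hu) (abs_nonneg _) ((abs_nonneg _).trans hB)
  obtain ⟨hst1, hst2⟩ := integral_sub_rpow (a := s) (b := t) (c := s) hα1
  obtain ⟨htT1, htT2⟩ := integral_sub_rpow (a := t) (b := T) (c := t) hα1
  obtain ⟨htS1, htS2⟩ := integral_sub_rpow (a := t) (b := T) (c := s) hα1
  have z0 : (0 : ℝ) ^ (1 - α) = 0 := Real.zero_rpow h1α.ne'
  rw [sub_self, z0, sub_zero] at hst2 htT2
  have p1 := intervalIntegrable_and_abs_integral_le (maj := fun _ => 0) hs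
    (hm' le_rfl (hst.trans ht)) (fun u hu => by
      have : D u = 0 := weylLeft_cut_sub_of_lt φ hu hst
      simp [this]) (by simp)
  have p2 := intervalIntegrable_and_abs_integral_le
    (maj := fun u => (c * (K * ((u - s) ^ (-α) + α))) * M) hst
    (hm' hs ht) (fun u hu => hDG ⟨hs.trans_lt hu.1, hu.2.trans_le ht⟩
      (h.abs_weylLeft_cut_sub_le_of_mem hα hα1 hs ht hu))
    ((((hst1.add intervalIntegrable_const).const_mul K).const_mul c).mul_const M)
  have p3 := intervalIntegrable_and_abs_integral_le
    (maj := fun u => (c * (K * ((u - t) ^ (-α) - (u - s) ^ (-α)))) * M) ht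
    (hm' (hs.trans hst) le_rfl) (fun u hu => hDG ⟨(hs.trans hst).trans_lt hu.1, hu.2⟩
      (h.abs_weylLeft_cut_sub_le_of_gt hα hα1 hs hst hu))
    ((((htT1.sub htS1).const_mul K).const_mul c).mul_const M)
  refine ⟨(p1.1.trans p2.1).trans p3.1, ?_⟩
  rw [← intervalIntegral.integral_add_adjacent_intervals (p1.1.trans p2.1) p3.1,
    ← intervalIntegral.integral_add_adjacent_intervals p1.1 p2.1]
  have q1 := p1.2
  have q2 := p2.2
  have q3 := p3.2
  rw [intervalIntegral.integral_zero] at q1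
  rw [intervalIntegral.integral_mul_const, intervalIntegral.integral_const_mul,
    intervalIntegral.integral_const_mul,
    intervalIntegral.integral_add hst1 intervalIntegrable_const, hst2,
    intervalIntegral.integral_const, smul_eq_mul] at q2
  rw [intervalIntegral.integral_mul_const, intervalIntegral.integral_const_mul,
    intervalIntegral.integral_const_mul,
    intervalIntegral.integral_sub htT1 htS1, htT2, htS2] at q3
  have hts : (T - t) ^ (1 - α) ≤ (T - s) ^ (1 - α) :=
    Real.rpow_le_rpow (by linarith) (by linarith) h1α.le
  have hlin := le_rpow_mul_rpow hα (sub_nonneg.2 hst) (show t - s ≤ T by linarith)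
  set R := (t - s) ^ (1 - α)
  -- The middle piece yields one `R / (1 - α)` and the term `α * T ^ α`. The last piece yields the
  -- second `R / (1 - α)`, once the nonpositive difference of `(T - t)^(1-α)` and `(T - s)^(1-α)` is
  -- dropped.
  have q2' : c * (K * (R / (1 - α) + (t - s) * α)) * M ≤
      c * (K * (R / (1 - α) + (T ^ α * R) * α)) * M := by gcongr
  have q3' : c * (K * ((T - t) ^ (1 - α) / (1 - α) -
      ((T - s) ^ (1 - α) - R) / (1 - α))) * M ≤ c * (K * (R / (1 - α))) * M := by
    gcongr
    rw [← sub_div]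
    gcongr
    linarith
  have hsum := (abs_add_le ((∫ u in (0 : ℝ)..s, D u * G u) + ∫ u in s..t, D u * G u)
    (∫ u in t..T, D u * G u)).trans (add_le_add_left (abs_add_le _ _) _)
  refine hsum.trans ?_
  have e : stieltjesConst α T * K * M * R = 0 + c * (K * (R / (1 - α) + (T ^ α * R) * α)) * M +
      c * (K * (R / (1 - α))) * M := by
    unfold stieltjesConst
    rw [← hcdef]
    ring
  rw [e]
  exact add_le_add (add_le_add q1 (q2.trans q2')) (q3.trans q3')

theorem abs_stieltjes_sub_le (h : FracBounded α T K φ) {γ : ℝ → ℝ} {M s t : ℝ}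
    (hα : 0 < α) (hα1 : α < 1) (hs : 0 ≤ s) (hst : s ≤ t) (ht : t ≤ T)
    (hG : AEStronglyMeasurable (weylRight (1 - α) T (leftShift γ T))
      (volume.restrict (Ioo 0 T)))
    (hM0 : 0 ≤ M) (hM : ∀ u ∈ Ioo 0 T, |weylRight (1 - α) T (leftShift γ T) u| ≤ M) :
    |stieltjes α T ((Ioo 0 t).indicator φ) γ - stieltjes α T ((Ioo 0 s).indicator φ) γ| ≤
      stieltjesConst α T * K * M * (t - s) ^ (1 - α) := by
  -- The cut-off on the empty interval has zero derivative, so the difference estimate with `s = 0`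
  -- gives integrability of each single product.
  have hzero : ∀ u, weylLeft α ((Ioo 0 (0 : ℝ)).indicator φ) u = 0 := by
    intro u
    simp [weylLeft]
  have hint : ∀ {t : ℝ}, 0 ≤ t → t ≤ T → IntervalIntegrable
      (fun u => weylLeft α ((Ioo 0 t).indicator φ) u * weylRight (1 - α) T (leftShift γ T) u)
      volume 0 T := by
    intro t ht0 ht
    have := (h.integral_weylLeft_cut_sub_mul hα hα1 le_rfl ht0 ht hG hM0 hM).1
    simpa only [hzero, sub_zero] using this
  have hkey := (h.integral_weylLeft_cut_sub_mul hα hα1 hs hst ht hG hM0 hM).2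
  simp only [sub_mul] at hkey
  rw [intervalIntegral.integral_sub (hint (hs.trans hst) ht) (hint hs (hst.trans ht))] at hkey
  unfold stieltjes
  rw [neg_sub_neg, abs_sub_comm]
  exact hkey

end FracBounded

/-! ### The driver: right Weyl derivatives and `Lam`. -/

theorem measurable_indicator_of_domRestrict {E : Type*} [MeasurableSpace E] [Zero E]
    {f : ℝ → E} {s t : Set ℝ} (hs : MeasurableSet s) (hst : s ⊆ t)
    (hf : Measurable (t.domRestrict f)) : Measurable (s.indicator f) := by
  refine measurable_of_restrict_of_restrict_compl hs ?_ ?_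
  · have h : s.domRestrict (s.indicator f) = t.domRestrict f ∘ inclusion hst := by
      ext x
      simp
    rw [h]
    exact hf.comp (measurable_inclusion hst)
  · have h : sᶜ.domRestrict (s.indicator f) = fun _ => 0 := by
      ext x
      exact indicator_of_notMem x.2 f
    rw [h]
    exact measurable_const

theorem measurable_weylRight {a T : ℝ} {F : ℝ → ℝ} (hF : Measurable F) :
    Measurable (weylRight a T F) := by
  have hk : StronglyMeasurable (Function.uncurry fun s y : ℝ =>
      ((y - s) ^ (a + 1))⁻¹ • (F s - F y)) := by
    refine Measurable.stronglyMeasurable ?_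
    exact ((measurable_snd.sub measurable_fst).pow_const _).inv.smul
      ((hF.comp measurable_fst).sub (hF.comp measurable_snd))
  have h : Measurable fun s => ∫ y in s..T, ((y - s) ^ (a + 1))⁻¹ • (F s - F y) :=
    (stronglyMeasurable_intervalIntegral hk measurable_id measurable_const).measurable
  unfold weylRight
  have h1 : Measurable fun s : ℝ => ((T - s) ^ a)⁻¹ :=
    ((measurable_const.sub measurable_id).pow_const a).inv
  exact ((h1.smul hF).add (h.const_smul a)).const_smul (Real.Gamma (1 - a))⁻¹

theorem weylRight_leftShift {E : Type*} [NormedAddCommGroup E] [NormedSpace ℝ E] {g : ℝ → E}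
    {a s t : ℝ} (hs : 0 < s) (hst : s < t) :
    weylRight a t (leftShift g t) s = (Real.Gamma (1 - a))⁻¹ •
      (((t - s) ^ a)⁻¹ • (g s - Function.leftLim g t) +
        a • ∫ y in s..t, ((y - s) ^ (a + 1))⁻¹ • (g s - g y)) := by
  have h1 : leftShift g t s = g s - Function.leftLim g t :=
    indicator_of_mem (show s ∈ Ioo 0 t from ⟨hs, hst⟩) _
  have h2 : ∫ y in s..t, ((y - s) ^ (a + 1))⁻¹ • (leftShift g t s - leftShift g t y) =
      ∫ y in s..t, ((y - s) ^ (a + 1))⁻¹ • (g s - g y) := by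
    rw [intervalIntegral.integral_of_le hst.le, intervalIntegral.integral_of_le hst.le,
      integral_Ioc_eq_integral_Ioo, integral_Ioc_eq_integral_Ioo]
    refine setIntegral_congr_fun measurableSet_Ioo fun y hy => ?_
    have h3 : leftShift g t y = g y - Function.leftLim g t :=
      indicator_of_mem (show y ∈ Ioo 0 t from ⟨hs.trans hy.1, hy.2⟩) _
    simp only [h1, h3, sub_sub_sub_cancel_right]
  rw [weylRight, h2, h1]

namespace MemDriver

variable {m : ℕ} {α T : ℝ} {g : ℝ → Vec m}

theorem pair_le (h : MemDriver α T g) {s t : ℝ} (hs : 0 < s) (hst : s < t) (ht : t < T) :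
    ‖g t - g s‖ₑ / ENNReal.ofReal ((t - s) ^ (1 - α)) +
      ∫⁻ y in Ioo s t, ‖g y - g s‖ₑ / ENNReal.ofReal ((y - s) ^ (2 - α)) ≤
        ENNReal.ofReal (driverNorm α T g).toReal := by
  rw [ENNReal.ofReal_toReal h.2.ne]
  exact le_iSup_of_le s (le_iSup_of_le t (le_iSup_of_le ⟨hs, hst, ht⟩ le_rfl))

theorem norm_sub_le (h : MemDriver α T g) {s t : ℝ} (hs : 0 < s) (hst : s < t) (ht : t < T) :
    ‖g t - g s‖ ≤ (driverNorm α T g).toReal * (t - s) ^ (1 - α) := by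
  have h1 := le_self_add.trans (h.pair_le hs hst ht)
  have hp : 0 < (t - s) ^ (1 - α) := Real.rpow_pos_of_pos (by linarith) _
  rw [← ofReal_norm, ← ENNReal.ofReal_div_of_pos hp,
    ENNReal.ofReal_le_ofReal_iff ENNReal.toReal_nonneg, div_le_iff₀ hp] at h1
  exact h1

theorem lintegral_kernel_le (h : MemDriver α T g) {s t : ℝ} (hs : 0 < s) (hst : s < t)
    (ht : t < T) :
    ∫⁻ y in Ioo s t, ‖((y - s) ^ (1 - α + 1))⁻¹ • (g s - g y)‖ₑ ≤
      ENNReal.ofReal (driverNorm α T g).toReal := by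
  refine le_trans (le_of_eq ?_) (le_add_self.trans (h.pair_le hs hst ht))
  refine setLIntegral_congr_fun measurableSet_Ioo fun y hy => ?_
  have hp : 0 < (y - s) ^ (2 - α) := Real.rpow_pos_of_pos (by linarith [hy.1]) _
  rw [show 1 - α + 1 = 2 - α by ring, enorm_smul, enorm_sub_rev, mul_comm, ENNReal.div_eq_inv_mul,
    mul_comm, Real.enorm_of_nonneg (inv_nonneg.2 hp.le), ENNReal.ofReal_inv_of_pos hp]

theorem measurable_indicator (h : MemDriver α T g) : Measurable ((Ioo 0 T).indicator g) :=
  measurable_indicator_of_domRestrict measurableSet_Ioo Ioo_subset_Icc_self h.1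

theorem aestronglyMeasurable_kernel (h : MemDriver α T g) {s t : ℝ} (hs : 0 < s) (ht : t ≤ T) :
    AEStronglyMeasurable (fun y => ((y - s) ^ (1 - α + 1))⁻¹ • (g s - g y))
      (volume.restrict (Ioo s t)) := by
  have hg : AEStronglyMeasurable g (volume.restrict (Ioo s t)) := by
    refine h.measurable_indicator.aestronglyMeasurable.congr ?_
    filter_upwards [ae_restrict_mem measurableSet_Ioo] with y hy
    exact indicator_of_mem (show y ∈ Ioo 0 T from ⟨hs.trans hy.1, hy.2.trans_le ht⟩) g
  have h2 : Measurable fun y : ℝ => (y - s) ^ (1 - α + 1) := by fun_prop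
  exact h2.inv.aestronglyMeasurable.smul (aestronglyMeasurable_const.sub hg)

/-- The driver norm only controls intervals ending strictly before `T`. Up to an intermediate point
it gives integrability directly; beyond that point the kernel is away from its singularity and the
Hölder bound on `g` makes the integrand bounded. -/
theorem intervalIntegrable_kernel (h : MemDriver α T g) (hα1 : α < 1) {s : ℝ} (hs : 0 < s)
    (hsT : s < T) :
    IntervalIntegrable (fun y => ((y - s) ^ (1 - α + 1))⁻¹ • (g s - g y)) volume s T := by
  obtain ⟨r, hsr, hrT⟩ := exists_between hsT
  have h1 : IntervalIntegrable (fun y => ((y - s) ^ (1 - α + 1))⁻¹ • (g s - g y)) volume s r := by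
    rw [intervalIntegrable_iff_integrableOn_Ioo_of_le hsr.le]
    exact ⟨h.aestronglyMeasurable_kernel hs hrT.le,
      (h.lintegral_kernel_le hs hsr hrT).trans_lt ENNReal.ofReal_lt_top⟩
  refine h1.trans ?_
  rw [intervalIntegrable_iff_integrableOn_Ioo_of_le hrT.le]
  set N := (driverNorm α T g).toReal
  have hN : 0 ≤ N := ENNReal.toReal_nonneg
  refine Integrable.mono'
    (integrable_const (((r - s) ^ (1 - α + 1))⁻¹ * (N * (T - s) ^ (1 - α))))
    ((h.aestronglyMeasurable_kernel hs le_rfl).mono_measure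
      (Measure.restrict_mono (Ioo_subset_Ioo_left hsr.le) le_rfl)) ?_
  filter_upwards [ae_restrict_mem measurableSet_Ioo] with y hy
  have hp : 0 < (r - s) ^ (1 - α + 1) := Real.rpow_pos_of_pos (by linarith) _
  have hsy : s < y := hsr.trans hy.1
  have hp' : (r - s) ^ (1 - α + 1) ≤ (y - s) ^ (1 - α + 1) :=
    Real.rpow_le_rpow (by linarith) (by linarith [hy.1]) (by linarith)
  rw [norm_smul, norm_inv, Real.norm_of_nonneg (hp.le.trans hp'), norm_sub_rev]
  refine mul_le_mul ((inv_le_inv₀ (hp.trans_le hp') hp).2 hp') ?_ (norm_nonneg _)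
    (inv_nonneg.2 hp.le)
  refine (h.norm_sub_le hs hsy hy.2).trans ?_
  exact mul_le_mul_of_nonneg_left
    (Real.rpow_le_rpow (by linarith) (by linarith [hy.2]) (by linarith)) hN

theorem tendsto_modulus (N : ℝ) {a t : ℝ} (ha : 0 < a) :
    Tendsto (fun u => N * (t - u) ^ a) (𝓝[<] t) (𝓝 0) := by
  have h1 : Continuous fun u : ℝ => N * (t - u) ^ a :=
    continuous_const.mul ((continuous_const.sub continuous_id).rpow_const
      fun _ => Or.inr ha.le)
  have h2 := (h1.tendsto t).mono_left (nhdsWithin_le_nhds (s := Iio t))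
  simpa [Real.zero_rpow ha.ne'] using h2

theorem leftLim_eq (h : MemDriver α T g) (hα1 : α < 1) {t : ℝ} (ht0 : 0 < t) (ht : t < T) :
    Function.leftLim g t = g t := by
  refine leftLim_eq_of_tendsto ?_
  rw [tendsto_iff_norm_sub_tendsto_zero]
  refine squeeze_zero' (Eventually.of_forall fun _ => norm_nonneg _) ?_
    (tendsto_modulus (driverNorm α T g).toReal (sub_pos.2 hα1))
  filter_upwards [Ioo_mem_nhdsLT ht0] with u hu
  rw [norm_sub_rev]
  exact h.norm_sub_le hu.1 hu.2 ht

/-- The value `g T` is unconstrained, so the left limit has to be produced from the uniform Hölder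
bound on `(0,T)` by a Cauchy argument. -/
theorem tendsto_leftLim (h : MemDriver α T g) (hα1 : α < 1) (hT : 0 < T) :
    Tendsto g (𝓝[<] T) (𝓝 (Function.leftLim g T)) := by
  refine tendsto_leftLim_of_tendsto ?_
  rw [← cauchy_map_iff_exists_tendsto]
  refine Metric.cauchy_iff.2 ⟨inferInstance, fun ε hε => ?_⟩
  set N := (driverNorm α T g).toReal
  have hN : 0 ≤ N := ENNReal.toReal_nonneg
  obtain ⟨u, huε, hu⟩ := (((tendsto_modulus N (t := T) (sub_pos.2 hα1)).eventually_lt_const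
    hε).and (Ioo_mem_nhdsLT hT)).exists
  refine ⟨g '' Ioo u T, image_mem_map (Ioo_mem_nhdsLT hu.2), ?_⟩
  have key : ∀ y ∈ Ioo u T, ∀ z ∈ Ioo u T, y < z → ‖g z - g y‖ < ε := by
    intro y hy z hz hyz
    refine (h.norm_sub_le (hu.1.trans hy.1) hyz hz.2).trans_lt (lt_of_le_of_lt ?_ huε)
    exact mul_le_mul_of_nonneg_left
      (Real.rpow_le_rpow (by linarith) (by linarith [hz.2, hy.1]) (by linarith)) hN
  rintro _ ⟨y, hy, rfl⟩ _ ⟨z, hz, rfl⟩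
  rcases lt_trichotomy y z with hyz | rfl | hyz
  · rw [dist_eq_norm, norm_sub_rev]
    exact key y hy z hz hyz
  · simpa using hε
  · rw [dist_eq_norm]
    exact key z hz y hy hyz

theorem norm_weylRight_le (h : MemDriver α T g) (hα : 0 < α) (hα1 : α < 1) {s t : ℝ}
    (hs : 0 < s) (hst : s < t) (ht : t < T) :
    ‖weylRight (1 - α) t (leftShift g t) s‖ ≤
      (Real.Gamma α)⁻¹ * ((driverNorm α T g).toReal +
        (1 - α) * (driverNorm α T g).toReal) := by
  set N := (driverNorm α T g).toReal
  have hN : 0 ≤ N := ENNReal.toReal_nonneg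
  have hΓ := (Real.Gamma_pos_of_pos hα).le
  rw [weylRight_leftShift hs hst, h.leftLim_eq hα1 (hs.trans hst) ht, sub_sub_cancel, norm_smul,
    norm_inv, Real.norm_of_nonneg hΓ]
  refine mul_le_mul_of_nonneg_left ((norm_add_le _ _).trans (add_le_add ?_ ?_))
    (inv_nonneg.2 hΓ)
  · have hp : 0 < (t - s) ^ (1 - α) := Real.rpow_pos_of_pos (by linarith) _
    rw [norm_smul, norm_inv, Real.norm_of_nonneg hp.le, inv_mul_le_iff₀ hp, norm_sub_rev, mul_comm]
    exact h.norm_sub_le hs hst ht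
  · rw [norm_smul, Real.norm_of_nonneg (by linarith)]
    refine mul_le_mul_of_nonneg_left ?_ (by linarith)
    have h1 := (enorm_integral_le_lintegral_enorm (μ := volume.restrict (Ioo s t))
      (fun y => ((y - s) ^ (1 - α + 1))⁻¹ • (g s - g y))).trans (h.lintegral_kernel_le hs hst ht)
    rw [intervalIntegral.integral_of_le hst.le, integral_Ioc_eq_integral_Ioo]
    rw [← ofReal_norm] at h1
    exact (ENNReal.ofReal_le_ofReal_iff hN).1 h1

theorem Lam_lt_top (h : MemDriver α T g) (hα : 0 < α) (hα1 : α < 1) : Lam α T g < ∞ := by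
  refine ENNReal.mul_lt_top ENNReal.ofReal_lt_top (lt_of_le_of_lt ?_
    (ENNReal.ofReal_lt_top (r := (Real.Gamma α)⁻¹ * ((driverNorm α T g).toReal +
        (1 - α) * (driverNorm α T g).toReal))))
  refine iSup_le fun s => iSup_le fun t => iSup_le fun hst => ?_
  rw [← ofReal_norm]
  exact ENNReal.ofReal_le_ofReal (h.norm_weylRight_le hα hα1 hst.1 hst.2.1 hst.2.2)

theorem norm_weylRight_le_Lam (h : MemDriver α T g) (hα : 0 < α) (hα1 : α < 1) {s t : ℝ}
    (hs : 0 < s) (hst : s < t) (ht : t < T) :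
    ‖weylRight (1 - α) t (leftShift g t) s‖ ≤ Real.Gamma (1 - α) * (Lam α T g).toReal := by
  have hΓ : 0 < Real.Gamma (1 - α) := Real.Gamma_pos_of_pos (by linarith)
  have h1 : ENNReal.ofReal ((Real.Gamma (1 - α))⁻¹ *
      ‖weylRight (1 - α) t (leftShift g t) s‖) ≤ Lam α T g := by
    rw [ENNReal.ofReal_mul (inv_nonneg.2 hΓ.le), ofReal_norm]
    refine mul_le_mul_right ?_ _
    exact le_iSup_of_le s (le_iSup_of_le t (le_iSup_of_le ⟨hs, hst, ht⟩ le_rfl))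
  rw [ENNReal.ofReal_le_iff_le_toReal (h.Lam_lt_top hα hα1).ne, inv_mul_le_iff₀ hΓ] at h1
  exact h1

/-- The derivatives at `t < T` are bounded through `Lam` and converge as `t ↑ T`: there `g(t-) = g
t` tends to `g(T-)`, and the kernel integral is continuous in its upper limit. -/
theorem norm_weylRight_terminal_le (h : MemDriver α T g) (hα : 0 < α) (hα1 : α < 1) {s : ℝ}
    (hs : 0 < s) (hsT : s < T) :
    ‖weylRight (1 - α) T (leftShift g T) s‖ ≤ Real.Gamma (1 - α) * (Lam α T g).toReal := by
  have hint := h.intervalIntegrable_kernel hα1 hs hsT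
  have hI : Tendsto (fun t => ∫ y in s..t, ((y - s) ^ (1 - α + 1))⁻¹ • (g s - g y)) (𝓝[<] T)
      (𝓝 (∫ y in s..T, ((y - s) ^ (1 - α + 1))⁻¹ • (g s - g y))) := by
    have hc := intervalIntegral.continuousOn_primitive_interval' hint left_mem_uIcc
    rw [uIcc_of_le hsT.le] at hc
    refine (hc T ⟨hsT.le, le_rfl⟩).mono_left ?_
    rw [← nhdsWithin_Ioo_eq_nhdsLT hsT]
    exact nhdsWithin_mono _ Ioo_subset_Icc_self
  have hP : Tendsto (fun t : ℝ => ((t - s) ^ (1 - α))⁻¹) (𝓝[<] T) (𝓝 ((T - s) ^ (1 - α))⁻¹) := by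
    refine Tendsto.mono_left ?_ nhdsWithin_le_nhds
    have hc : ContinuousAt (fun t : ℝ => ((t - s) ^ (1 - α))⁻¹) T :=
      ContinuousAt.inv₀ (ContinuousAt.rpow_const (by fun_prop) (Or.inl (by linarith)))
        (Real.rpow_pos_of_pos (by linarith) _).ne'
    exact hc
  have hlim := ((hP.smul ((tendsto_const_nhds (x := g s)).sub (h.tendsto_leftLim hα1 (hs.trans hsT)))).add
    (hI.const_smul (1 - α))).const_smul (Real.Gamma (1 - (1 - α)))⁻¹
  rw [weylRight_leftShift hs hsT]
  refine le_of_tendsto hlim.norm ?_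
  filter_upwards [Ioo_mem_nhdsLT hsT] with t ht
  have h1 := h.norm_weylRight_le_Lam hα hα1 hs ht.1 ht.2
  rw [weylRight_leftShift hs ht.1, h.leftLim_eq hα1 (hs.trans ht.1) ht.2] at h1
  exact h1

/-- `stieltjes` is scalar while `Lam` is built from the vector-valued driver. The left limit exists
and the kernel is integrable, so both commute with coordinate projections. -/
theorem weylRight_apply (h : MemDriver α T g) (hα1 : α < 1) (j : Fin m) {s : ℝ}
    (hs : 0 < s) (hsT : s < T) :
    weylRight (1 - α) T (leftShift (fun u => g u j) T) s =
      weylRight (1 - α) T (leftShift g T) s j := by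
  have hlim : Function.leftLim (fun u => g u j) T = Function.leftLim g T j :=
    leftLim_eq_of_tendsto (((EuclideanSpace.proj (𝕜 := ℝ) j).continuous.tendsto _).comp
      (h.tendsto_leftLim hα1 (hs.trans hsT)))
  have hI : ∫ y in s..T, ((y - s) ^ (1 - α + 1))⁻¹ • (g s j - g y j) =
      (∫ y in s..T, ((y - s) ^ (1 - α + 1))⁻¹ • (g s - g y)) j :=
    (EuclideanSpace.proj (𝕜 := ℝ) j).intervalIntegral_comp_comm
      (h.intervalIntegrable_kernel hα1 hs hsT)
  rw [weylRight_leftShift hs hsT, weylRight_leftShift hs hsT, hlim]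
  simp only [PiLp.smul_apply, PiLp.add_apply, PiLp.sub_apply]
  rw [hI]

theorem abs_weylRight_apply_le (h : MemDriver α T g) (hα : 0 < α) (hα1 : α < 1) (j : Fin m) :
    ∀ s ∈ Ioo 0 T, |weylRight (1 - α) T (leftShift (fun u => g u j) T) s| ≤
      Real.Gamma (1 - α) * (Lam α T g).toReal := by
  intro s hs
  rw [h.weylRight_apply hα1 j hs.1 hs.2, ← Real.norm_eq_abs]
  exact (PiLp.norm_apply_le _ j).trans (h.norm_weylRight_terminal_le hα hα1 hs.1 hs.2)

theorem measurable_weylRight_apply (h : MemDriver α T g) (j : Fin m) :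
    Measurable (weylRight (1 - α) T (leftShift (fun u => g u j) T)) := by
  refine measurable_weylRight (measurable_indicator_of_domRestrict measurableSet_Ioo
    Ioo_subset_Icc_self ?_)
  have h1 : Measurable fun x : Icc 0 T => g x j :=
    (EuclideanSpace.proj (𝕜 := ℝ) j).continuous.measurable.comp h.1
  exact h1.sub_const _

end MemDriver

/-! ### The vector-valued integral and its delayed integrand. -/

theorem norm_le_sum_abs {n : ℕ} (v : Vec n) : ‖v‖ ≤ ∑ i, |v i| := by
  rw [EuclideanSpace.norm_eq]
  refine Real.sqrt_le_iff.2 ⟨Finset.sum_nonneg fun _ _ => abs_nonneg _, ?_⟩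
  exact Finset.sum_sq_le_sq_sum_of_nonneg fun _ _ => norm_nonneg _

theorem norm_le_card_mul {n : ℕ} {v : Vec n} {c : ℝ} (h : ∀ i, |v i| ≤ c) : ‖v‖ ≤ n * c := by
  refine (norm_le_sum_abs v).trans ((Finset.sum_le_sum fun i _ => h i).trans (le_of_eq ?_))
  simp

theorem norm_stieltjesTo_sub_le {d m : ℕ} {α T K s t : ℝ} {F : ℝ → Mat d m} {g : ℝ → Vec m}
    (hα : 0 < α) (hα1 : α < 1) (hF : ∀ i j, FracBounded α T K fun u => F u (i, j))
    (hg : MemDriver α T g) (hs : 0 ≤ s) (hst : s ≤ t) (ht : t ≤ T) :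
    ‖stieltjesTo α T F g t - stieltjesTo α T F g s‖ ≤
      d * (m * (stieltjesConst α T * K * (Real.Gamma (1 - α) * (Lam α T g).toReal) *
        (t - s) ^ (1 - α))) := by
  refine norm_le_card_mul fun i => ?_
  have hM0 : 0 ≤ Real.Gamma (1 - α) * (Lam α T g).toReal :=
    mul_nonneg (Real.Gamma_pos_of_pos (by linarith)).le ENNReal.toReal_nonneg
  have h1 : (stieltjesTo α T F g t - stieltjesTo α T F g s) i =
      ∑ j : Fin m, (stieltjes α T ((Ioo 0 t).indicator fun u => F u (i, j)) (fun u => g u j) -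
        stieltjes α T ((Ioo 0 s).indicator fun u => F u (i, j)) (fun u => g u j)) := by
    rw [Finset.sum_sub_distrib]
    rfl
  rw [h1]
  refine (Finset.abs_sum_le_sum_abs _ _).trans
    ((Finset.sum_le_sum fun j _ => (hF i j).abs_stieltjes_sub_le hα hα1 hs hst ht
      (hg.measurable_weylRight_apply j).aestronglyMeasurable hM0
      (hg.abs_weylRight_apply_le hα hα1 j)).trans (le_of_eq ?_))
  simp

theorem lintegral_rpow_sub {κ u : ℝ} (hκ : 0 < κ) (hu : 0 ≤ u) :
    ∫⁻ v in Ioo 0 u, ENNReal.ofReal ((u - v) ^ (κ - 1)) = ENNReal.ofReal (u ^ κ / κ) := by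
  have hint : IntervalIntegrable (fun v => (u - v) ^ (κ - 1)) volume 0 u := by
    have h := (intervalIntegral.intervalIntegrable_rpow' (a := u) (b := 0)
      (show -1 < κ - 1 by linarith)).comp_sub_left u
    simpa using h
  rw [← ofReal_integral_eq_lintegral_ofReal, ← integral_Ioc_eq_integral_Ioo,
    ← intervalIntegral.integral_of_le hu,
    intervalIntegral.integral_comp_sub_left (fun v => v ^ (κ - 1)),
    integral_rpow (Or.inl (by linarith))]
  · simp [Real.zero_rpow hκ.ne']
  · exact (intervalIntegrable_iff_integrableOn_Ioo_of_le hu).1 hint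
  · filter_upwards [ae_restrict_mem measurableSet_Ioo] with v hv
    exact Real.rpow_nonneg (by linarith [hv.2]) _

/-- The time modulus leaves `(u - v)^(β - α - 1)`, integrable because `α < β`; the space modulus is
dominated by `M` times the fractional increments of `X`. -/
theorem FracBounded.of_modulus {E : Type*} [NormedAddCommGroup E] {α β T B K M N : ℝ}
    {φ : ℝ → ℝ} {X : ℝ → E} (hα : 0 < α) (hαβ : α < β) (hM : 0 ≤ M) (hN : 0 ≤ N)
    (hX : ContinuousOn X (Icc 0 T))
    (hinc : ∀ u ∈ Icc 0 T, ∫⁻ v in Ioo 0 u,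
      ‖X u - X v‖ₑ / ENNReal.ofReal ((u - v) ^ (α + 1)) ≤ ENNReal.ofReal N)
    (hφ : ∀ u ∈ Icc 0 T, ∀ v ∈ Icc 0 T, |φ u - φ v| ≤ M * |u - v| ^ β + M * ‖X u - X v‖)
    (hB : ∀ u ∈ Icc 0 T, |φ u| ≤ B) (hBK : B ≤ K)
    (hK : M * (T ^ (β - α) / (β - α)) + M * N ≤ K) :
    FracBounded α T K φ := by
  have hβ : 0 < β := hα.trans hαβ
  refine ⟨fun u hu => ?_, fun u hu => (hB u hu).trans hBK, fun u hu => ?_⟩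
  · rw [ContinuousWithinAt, tendsto_iff_norm_sub_tendsto_zero]
    have h1 : Tendsto (fun v => M * |v - u| ^ β + M * ‖X v - X u‖) (𝓝[Icc 0 T] u) (𝓝 0) := by
      have h2 : ContinuousWithinAt (fun v => M * |v - u| ^ β + M * ‖X v - X u‖) (Icc 0 T) u := by
        refine ContinuousWithinAt.add ?_ (((hX u hu).sub continuousWithinAt_const).norm.const_mul M)
        refine (Continuous.continuousWithinAt ?_)
        exact continuous_const.mul
          ((continuous_id.sub continuous_const).abs.rpow_const fun _ => Or.inr hβ.le)
      have h3 := h2.tendsto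
      simpa [Real.zero_rpow hβ.ne'] using h3
    refine squeeze_zero' (Eventually.of_forall fun _ => norm_nonneg _) ?_ h1
    filter_upwards [self_mem_nhdsWithin] with v hv
    exact hφ v hv u hu
  · have hκ : 0 < β - α := by linarith
    have hm : Measurable fun v : ℝ => ENNReal.ofReal M * ENNReal.ofReal ((u - v) ^ (β - α - 1)) := by
      fun_prop
    calc ∫⁻ v in Ioo 0 u, ‖φ u - φ v‖ₑ / ENNReal.ofReal ((u - v) ^ (α + 1))
        ≤ ∫⁻ v in Ioo 0 u, (ENNReal.ofReal M * ENNReal.ofReal ((u - v) ^ (β - α - 1)) +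
            ENNReal.ofReal M * (‖X u - X v‖ₑ / ENNReal.ofReal ((u - v) ^ (α + 1)))) := by
          refine setLIntegral_mono' measurableSet_Ioo fun v hv => ?_
          have huv : 0 < u - v := by linarith [hv.2]
          have hp : 0 < (u - v) ^ (α + 1) := Real.rpow_pos_of_pos huv _
          rw [enorm_div_ofReal hp, ← ofReal_norm (X u - X v), ← ENNReal.ofReal_div_of_pos hp,
            ← ENNReal.ofReal_mul hM, ← ENNReal.ofReal_mul hM,
            ← ENNReal.ofReal_add (by positivity) (by positivity), ← ofReal_norm]
          refine ENNReal.ofReal_le_ofReal ?_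
          rw [Real.norm_eq_abs, abs_div, abs_of_pos hp, div_le_iff₀ hp]
          refine (hφ u hu v ⟨hv.1.le, hv.2.le.trans hu.2⟩).trans (le_of_eq ?_)
          rw [add_mul, abs_of_pos huv, mul_assoc, ← Real.rpow_add huv, mul_assoc,
            div_mul_cancel₀ _ hp.ne']
          ring_nf
      _ = ENNReal.ofReal M * ENNReal.ofReal (u ^ (β - α) / (β - α)) + ENNReal.ofReal M *
            ∫⁻ v in Ioo 0 u, ‖X u - X v‖ₑ / ENNReal.ofReal ((u - v) ^ (α + 1)) := by
          rw [lintegral_add_left hm, lintegral_const_mul' _ _ ENNReal.ofReal_ne_top,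
            lintegral_const_mul' _ _ ENNReal.ofReal_ne_top, lintegral_rpow_sub hκ hu.1]
      _ ≤ ENNReal.ofReal M * ENNReal.ofReal (T ^ (β - α) / (β - α)) +
            ENNReal.ofReal M * ENNReal.ofReal N := by
          gcongr
          · exact hu.1
          · exact hu.2
          · exact hinc u hu
      _ ≤ ENNReal.ofReal K := by
          have hT : 0 ≤ T := hu.1.trans hu.2
          rw [← ENNReal.ofReal_mul hM, ← ENNReal.ofReal_mul hM,
            ← ENNReal.ofReal_add (by positivity) (by positivity)]
          exact ENNReal.ofReal_le_ofReal hK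

section WNorm

variable {E : Type*} [NormedAddCommGroup E] {α s t : ℝ} {x : ℝ → E}

theorem wNorm_term_le (hx : wNorm α s t x < ∞) {u : ℝ} (hu : u ∈ Icc s t) :
    ‖x u‖ₑ + ∫⁻ v in Ioo s u, ‖x u - x v‖ₑ / ENNReal.ofReal ((u - v) ^ (α + 1)) ≤
      ENNReal.ofReal (wNorm α s t x).toReal := by
  rw [ENNReal.ofReal_toReal hx.ne]
  exact le_iSup₂_of_le (f := fun u (_ : u ∈ Icc s t) => ‖x u‖ₑ +
    ∫⁻ v in Ioo s u, ‖x u - x v‖ₑ / ENNReal.ofReal ((u - v) ^ (α + 1))) u hu le_rfl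

theorem norm_le_wNorm (hx : wNorm α s t x < ∞) {u : ℝ} (hu : u ∈ Icc s t) :
    ‖x u‖ ≤ (wNorm α s t x).toReal := by
  have h := le_self_add.trans (wNorm_term_le hx hu)
  rw [← ofReal_norm] at h
  exact (ENNReal.ofReal_le_ofReal_iff ENNReal.toReal_nonneg).1 h

/-- Translation by the delay turns the increments over `(0,u)` into those of `x` over `(-r, u-r)`,
already part of `wNorm`. -/
theorem lintegral_shift_le {r T : ℝ} (hr : 0 ≤ r) (hx : wNorm α (-r) T x < ∞) {u : ℝ}
    (hu : u ∈ Icc 0 T) :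
    ∫⁻ v in Ioo 0 u, ‖x (u - r) - x (v - r)‖ₑ / ENNReal.ofReal ((u - v) ^ (α + 1)) ≤
      ENNReal.ofReal (wNorm α (-r) T x).toReal := by
  have h := le_add_self.trans
    (wNorm_term_le hx (u := u - r) ⟨by linarith [hu.1], by linarith [hu.2]⟩)
  refine le_trans (le_of_eq ?_) h
  rw [← lintegral_indicator measurableSet_Ioo, ← lintegral_indicator measurableSet_Ioo]
  symm
  rw [← lintegral_sub_right_eq_self _ r]
  refine lintegral_congr fun v => ?_
  have hiff : v - r ∈ Ioo (-r) (u - r) ↔ v ∈ Ioo 0 u := by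
    simp only [mem_Ioo]
    constructor <;> rintro ⟨h1, h2⟩ <;> constructor <;> linarith
  by_cases hv : v ∈ Ioo 0 u
  · rw [indicator_of_mem hv, indicator_of_mem (hiff.2 hv), sub_sub_sub_cancel_right]
  · rw [indicator_of_notMem hv, indicator_of_notMem (fun h => hv (hiff.1 h))]

end WNorm

theorem diffusion_fracBounded {d m : ℕ} {r T α β M N : ℝ} {σ : ℝ → Vec d → Mat d m}
    {x : ℝ → Vec d} (hr : 0 ≤ r) (hα : 0 < α) (hαβ : α < β) (hM : 0 ≤ M)
    (hlip : ∀ x y : Vec d, ∀ t ∈ Icc 0 T, ‖σ t x - σ t y‖ ≤ M * ‖x - y‖)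
    (hhol : ∀ x : Vec d, ∀ t ∈ Icc 0 T, ∀ s ∈ Icc 0 T, ‖σ t x - σ s x‖ ≤ M * |t - s| ^ β)
    (hcont : ContinuousOn x (Icc (-r) T)) (hx : wNorm α (-r) T x < ∞)
    (hN : N = (wNorm α (-r) T x).toReal) (i : Fin d) (j : Fin m) :
    FracBounded α T ((‖σ 0 0‖ + M * T ^ β + M + M * (T ^ (β - α) / (β - α))) * (1 + N))
      fun u => σ u (x (u - r)) (i, j) := by
  have hN0 : 0 ≤ N := hN ▸ ENNReal.toReal_nonneg
  rcases lt_or_ge T 0 with hT | hT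
  · have he : Icc 0 T = ∅ := Icc_eq_empty (not_le.2 hT)
    exact ⟨by rw [he]; exact continuousOn_empty _, by simp [he], by simp [he]⟩
  have hκ : 0 < β - α := by linarith
  have hmem : ∀ u ∈ Icc 0 T, u - r ∈ Icc (-r) T := fun u hu =>
    ⟨by linarith [hu.1], by linarith [hu.2]⟩
  have hTβ : 0 ≤ M * T ^ β := by positivity
  have hTκ : 0 ≤ M * (T ^ (β - α) / (β - α)) := by positivity
  have hσ0 := norm_nonneg (σ 0 0)
  refine FracBounded.of_modulus (X := fun u => x (u - r)) (B := ‖σ 0 0‖ + M * T ^ β + M * N)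
    hα hαβ hM hN0 ?_ ?_ ?_ ?_ ?_ ?_
  · exact hcont.comp (by fun_prop) hmem
  · intro u hu
    rw [hN]
    exact lintegral_shift_le hr hx hu
  · intro u hu v hv
    have h1 : σ u (x (u - r)) (i, j) - σ v (x (v - r)) (i, j) =
        ((σ u (x (u - r)) - σ v (x (u - r))) + (σ v (x (u - r)) - σ v (x (v - r)))) (i, j) := by
      simp
    rw [h1, ← Real.norm_eq_abs]
    exact (PiLp.norm_apply_le _ _).trans ((norm_add_le _ _).trans
      (add_le_add (hhol _ u hu v hv) (hlip _ _ v hv)))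
  · intro u hu
    have h1 : σ u (x (u - r)) = σ 0 0 + (σ u 0 - σ 0 0) + (σ u (x (u - r)) - σ u 0) := by abel
    have h2 : ‖σ u (x (u - r))‖ ≤ ‖σ 0 0‖ + M * T ^ β + M * N := by
      rw [h1]
      refine (norm_add_le _ _).trans (add_le_add ((norm_add_le _ _).trans
        (add_le_add le_rfl ((hhol 0 u hu 0 ⟨le_rfl, hT⟩).trans ?_)))
        ((hlip _ _ u hu).trans ?_))
      · rw [sub_zero, abs_of_nonneg hu.1]
        exact mul_le_mul_of_nonneg_left (Real.rpow_le_rpow hu.1 hu.2 (hα.trans hαβ).le) hM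
      · rw [sub_zero, hN]
        exact mul_le_mul_of_nonneg_left (norm_le_wNorm hx (hmem u hu)) hM
    rw [← Real.norm_eq_abs]
    exact (PiLp.norm_apply_le _ _).trans h2
  · nlinarith [mul_nonneg hσ0 hN0, mul_nonneg hTβ hN0, mul_nonneg hTκ hN0]
  · nlinarith [mul_nonneg hσ0 hN0, mul_nonneg hTβ hN0, mul_nonneg hTκ hN0]

/-! ### The drift integral. -/

section Drift

variable {d : ℕ} {r T α : ℝ} {b : ℝ → PathSpace d r T → Vec d}

theorem pastSup_le_norm (t : ℝ) (p : PathSpace d r T) : pastSup t p ≤ ‖p‖ :=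
  Real.iSup_le (fun s => p.norm_coe_le_norm s.1) (norm_nonneg _)

theorem DriftHyp.aestronglyMeasurable (hb : DriftHyp r T (1 / α) b) (p : PathSpace d r T)
    {s t : ℝ} (hs : 0 ≤ s) (ht : t ≤ T) :
    AEStronglyMeasurable (fun u => b u p) (volume.restrict (Ioo s t)) := by
  let _ : MeasurableSpace (PathSpace d r T) := borel (PathSpace d r T)
  have h1 : Measurable fun u : Icc (0 : ℝ) T => b u p :=
    hb.measurable.comp (measurable_id.prodMk measurable_const)
  have h2 := aemeasurable_restrict_of_measurable_subtype (μ := volume) (f := fun u => b u p)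
    measurableSet_Icc h1
  exact (h2.mono_set (show Ioo s t ⊆ Icc 0 T from
    fun u hu => ⟨hs.trans hu.1.le, hu.2.le.trans ht⟩)).aestronglyMeasurable

/-- Hölder's inequality on `(s,t)` with exponents `1/α` and `1/(1-α)`. -/
theorem lintegral_enorm_le_of_memLp {b₀ : ℝ → ℝ} (hα : 0 < α) (hα1 : α ≤ 1)
    (hb₀ : MemLp b₀ (ENNReal.ofReal (1 / α)) (volume.restrict (Ioo 0 T)))
    {s t : ℝ} (hs : 0 ≤ s) (hst : s ≤ t) (ht : t ≤ T) :
    ∫⁻ u in Ioo s t, ‖b₀ u‖ₑ ≤ ENNReal.ofReal ((eLpNorm b₀ (ENNReal.ofReal (1 / α))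
      (volume.restrict (Ioo 0 T))).toReal * (t - s) ^ (1 - α)) := by
  have hp : 1 ≤ ENNReal.ofReal (1 / α) := by
    rw [ENNReal.one_le_ofReal]
    exact (one_le_div hα).2 hα1
  have hle : volume.restrict (Ioo s t) ≤ volume.restrict (Ioo 0 T) :=
    Measure.restrict_mono (Ioo_subset_Ioo hs ht) le_rfl
  have h1 := eLpNorm_le_eLpNorm_mul_rpow_measure_univ hp
    (hb₀.aestronglyMeasurable.mono_measure hle)
  rw [eLpNorm_one_eq_lintegral_enorm] at h1
  refine h1.trans ?_
  rw [ENNReal.ofReal_mul ENNReal.toReal_nonneg, ENNReal.ofReal_toReal hb₀.eLpNorm_lt_top.ne]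
  refine mul_le_mul' (eLpNorm_mono_measure _ hle) (le_of_eq ?_)
  rw [Measure.restrict_apply_univ, Real.volume_Ioo, ENNReal.toReal_one,
    ENNReal.toReal_ofReal (by positivity), one_div_one_div, div_one,
    ENNReal.ofReal_rpow_of_nonneg (by linarith) (by linarith)]

theorem drift_integral_bound {L N : ℝ} {b₀ : ℝ → ℝ} (hb : DriftHyp r T (1 / α) b)
    (hα : 0 < α) (hα1 : α ≤ 1) (hL : 0 ≤ L)
    (hb₀ : MemLp b₀ (ENNReal.ofReal (1 / α)) (volume.restrict (Ioo 0 T)))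
    (hgrowth : ∀ p : PathSpace d r T, ∀ t ∈ Icc 0 T, ‖b t p‖ ≤ L * pastSup t p + b₀ t)
    {p : PathSpace d r T} (hp : ‖p‖ ≤ N) {s t : ℝ} (hs : 0 ≤ s) (hst : s ≤ t) (ht : t ≤ T) :
    IntervalIntegrable (fun u => b u p) volume s t ∧
    ‖∫ u in s..t, b u p‖ ≤ (L * N * T ^ α + (eLpNorm b₀ (ENNReal.ofReal (1 / α))
      (volume.restrict (Ioo 0 T))).toReal) * (t - s) ^ (1 - α) := by
  set A := (eLpNorm b₀ (ENNReal.ofReal (1 / α)) (volume.restrict (Ioo 0 T))).toReal with hA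
  have hN : 0 ≤ N := (norm_nonneg _).trans hp
  have hT : 0 ≤ T := (hs.trans hst).trans ht
  have hA0 : 0 ≤ A := ENNReal.toReal_nonneg
  have hts : 0 ≤ t - s := by linarith
  have hpt : ∀ u ∈ Ioo s t, ‖b u p‖ₑ ≤ ENNReal.ofReal (L * N) + ‖b₀ u‖ₑ := by
    intro u hu
    have hu' : u ∈ Icc 0 T := ⟨hs.trans hu.1.le, hu.2.le.trans ht⟩
    rw [← ofReal_norm, ← ofReal_norm, ← ENNReal.ofReal_add (mul_nonneg hL hN) (norm_nonneg _)]
    refine ENNReal.ofReal_le_ofReal ((hgrowth p u hu').trans (add_le_add ?_ (le_abs_self _)))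
    exact mul_le_mul_of_nonneg_left ((pastSup_le_norm u p).trans hp) hL
  have hlin := lintegral_enorm_le_of_memLp hα hα1 hb₀ hs hst ht
  have hbound : ∫⁻ u in Ioo s t, ‖b u p‖ₑ ≤
      ENNReal.ofReal ((L * N * T ^ α + A) * (t - s) ^ (1 - α)) := by
    calc ∫⁻ u in Ioo s t, ‖b u p‖ₑ
        ≤ ∫⁻ u in Ioo s t, (ENNReal.ofReal (L * N) + ‖b₀ u‖ₑ) :=
          setLIntegral_mono' measurableSet_Ioo hpt
      _ = ENNReal.ofReal (L * N) * ENNReal.ofReal (t - s) + ∫⁻ u in Ioo s t, ‖b₀ u‖ₑ := by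
          rw [lintegral_add_left measurable_const, lintegral_const, Measure.restrict_apply_univ,
            Real.volume_Ioo]
      _ ≤ ENNReal.ofReal (L * N) * ENNReal.ofReal (T ^ α * (t - s) ^ (1 - α)) +
            ENNReal.ofReal (A * (t - s) ^ (1 - α)) := by
          gcongr
          exact le_rpow_mul_rpow hα hts (by linarith)
      _ = _ := by
          rw [← ENNReal.ofReal_mul (by positivity), ← ENNReal.ofReal_add (by positivity)
            (by positivity)]
          ring_nf
  refine ⟨?_, ?_⟩
  · rw [intervalIntegrable_iff_integrableOn_Ioo_of_le hst]
    exact ⟨hb.aestronglyMeasurable p hs ht, hbound.trans_lt ENNReal.ofReal_lt_top⟩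
  · rw [intervalIntegral.integral_of_le hst, integral_Ioc_eq_integral_Ioo]
    have h1 := (enorm_integral_le_lintegral_enorm (μ := volume.restrict (Ioo s t))
      (fun u => b u p)).trans hbound
    rw [← ofReal_norm] at h1
    exact (ENNReal.ofReal_le_ofReal_iff (by positivity)).1 h1

end Drift

/-! ### The regulator and the final estimate. -/

theorem abs_regulator_sub_le {T H a : ℝ} {z y : ℝ → ℝ} (ha : 0 ≤ a) (hH : 0 ≤ H)
    (hz : ∀ s t, 0 ≤ s → s ≤ t → t ≤ T → |z t - z s| ≤ H * (t - s) ^ a)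
    (hy : ∀ t ∈ Icc 0 T, IsGreatest ((fun s => max (-(z s)) 0) '' Icc 0 t) (y t))
    {s t : ℝ} (hs : 0 ≤ s) (hst : s ≤ t) (ht : t ≤ T) :
    |y t - y s| ≤ H * (t - s) ^ a := by
  have hys := hy s ⟨hs, hst.trans ht⟩
  have hyt := hy t ⟨hs.trans hst, ht⟩
  have hmono : y s ≤ y t := hyt.2 (image_mono (Icc_subset_Icc_right hst) hys.1)
  have hR : 0 ≤ H * (t - s) ^ a := mul_nonneg hH (Real.rpow_nonneg (by linarith) _)
  rw [abs_of_nonneg (sub_nonneg.2 hmono), sub_le_iff_le_add]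
  obtain ⟨u, hu, huy⟩ := hyt.1
  simp only at huy
  rw [← huy]
  -- If the maximum up to `t` is attained by time `s`, there is no increase. Otherwise it is
  -- attained at some `u` in `[s,t]`, and `y s` is at least the negative part of `z s`, which
  -- differs from that of `z u` by at most `|z u - z s|`.
  rcases le_total u s with hus | hsu
  · have := hys.2 ⟨u, ⟨hu.1, hus⟩, rfl⟩
    simp only at this
    linarith
  · have h1 : max (-(z s)) 0 ≤ y s := hys.2 ⟨s, ⟨hs, le_rfl⟩, rfl⟩
    have h2 := hz s u hs hsu (hu.2.trans ht)
    have h3 : H * (u - s) ^ a ≤ H * (t - s) ^ a :=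
      mul_le_mul_of_nonneg_left (Real.rpow_le_rpow (by linarith) (by linarith [hu.2]) ha) hH
    have h4 := neg_abs_le (z u - z s)
    have h5 := le_max_left (-(z s)) 0
    have h6 := le_max_right (-(z s)) 0
    exact max_le (by linarith) (by linarith)

theorem holderNorm_le {E : Type*} [NormedAddCommGroup E] {lam s t A H : ℝ} {f : ℝ → E}
    (hA : ∀ u ∈ Icc s t, ‖f u‖ ≤ A)
    (hH : ∀ u v, s ≤ u → u < v → v ≤ t → ‖f v - f u‖ ≤ H * (v - u) ^ lam) :
    holderNorm lam s t f ≤ ENNReal.ofReal A + ENNReal.ofReal H := by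
  refine add_le_add (iSup₂_le fun u hu => ?_)
    (iSup_le fun u => iSup_le fun v => iSup_le fun huv => ?_)
  · rw [← ofReal_norm]
    exact ENNReal.ofReal_le_ofReal (hA u hu)
  · have hp : 0 < (v - u) ^ lam := Real.rpow_pos_of_pos (by linarith [huv.2.1]) _
    rw [← ofReal_norm, ← ENNReal.ofReal_div_of_pos hp]
    refine ENNReal.ofReal_le_ofReal ?_
    rw [div_le_iff₀ hp]
    exact hH u v huv.1 huv.2.1 huv.2.2

theorem stieltjesTo_zero {d m : ℕ} (α T : ℝ) (F : ℝ → Mat d m) (g : ℝ → Vec m) :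
    stieltjesTo α T F g 0 = 0 := by
  ext i
  simp [stieltjesTo, stieltjes, weylLeft]

theorem norm_solution_sub_le {d : ℕ} {T H a : ℝ} {x z y : ℝ → Vec d} (ha : 0 ≤ a) (hH : 0 ≤ H)
    (hz : ∀ s t, 0 ≤ s → s ≤ t → t ≤ T → ‖z t - z s‖ ≤ H * (t - s) ^ a)
    (hy : ∀ t ∈ Icc 0 T, ∀ i, IsGreatest ((fun s => max (-(z s i)) 0) '' Icc 0 t) (y t i))
    (hx : ∀ t ∈ Icc 0 T, x t = z t + y t) {s t : ℝ} (hs : 0 ≤ s) (hst : s ≤ t) (ht : t ≤ T) :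
    ‖x t - x s‖ ≤ (1 + d) * H * (t - s) ^ a := by
  rw [hx t ⟨hs.trans hst, ht⟩, hx s ⟨hs, hst.trans ht⟩, add_sub_add_comm]
  have h1 : ‖y t - y s‖ ≤ d * (H * (t - s) ^ a) := by
    refine norm_le_card_mul fun i => ?_
    refine abs_regulator_sub_le (z := fun u => z u i) (y := fun u => y u i) ha hH ?_
      (fun u hu => hy u hu i) hs hst ht
    intro u v hu huv hv
    rw [← Real.norm_eq_abs]
    exact (PiLp.norm_apply_le (z v - z u) i).trans (hz u v hu huv hv)
  calc _ ≤ H * (t - s) ^ a + d * (H * (t - s) ^ a) :=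
        (norm_add_le _ _).trans (add_le_add (hz s t hs hst ht) h1)
    _ = _ := by ring

end ReflectedDelay

theorem mainTheorem3 {d m : ℕ} {r T α β : ℝ} (hr : 0 < r) (hT : 0 < T)
    (hα : 0 < α) (hα' : α < min (1 / 2) β)
    (σ : ℝ → Vec d → Mat d m) (hσ : DiffusionHyp T β σ)
    (b : ℝ → PathSpace d r T → Vec d) (hb : DriftHyp r T (1 / α) b) :
    ∃ d₆ : ℝ, 0 < d₆ ∧
      ∀ (g : ℝ → Vec m) (η x : ℝ → Vec d),
        MemDriver α T g →
        MemW α (-r) 0 η → (∀ t ∈ Icc (-r) 0, ∀ i, 0 ≤ η t i) →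
        IsSolution r T α b σ η g x →
          MemHolderOn (1 - α) 0 T x ∧
          holderNorm (1 - α) 0 T x ≤
            ENNReal.ofReal d₆ * (1 + Lam α T g) * (1 + wNorm α (-r) T x) := by
  have hα1 : α < 1 := by linarith [hα'.trans_le (min_le_left _ _)]
  have hαβ : α < β := hα'.trans_le (min_le_right _ _)
  have h1α : 0 < 1 - α := by linarith
  obtain ⟨M, hM, hlip, hhol⟩ := hσ.bounds
  obtain ⟨b₀, L, hb₀, hL, -, hgrowth⟩ := hb.bounds
  have hL0 := hL 0 le_rfl
  set Cσ : ℝ := ‖σ 0 0‖ + M * T ^ β + M + M * (T ^ (β - α) / (β - α)) with hCσ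
  set A : ℝ := (eLpNorm b₀ (ENNReal.ofReal (1 / α)) (volume.restrict (Ioo 0 T))).toReal with hA
  -- The factor `d` comes from bounding the norm by coordinates, `m` from the sum over driver
  -- components, and the Gamma factor from the normalization in `Lam`.
  set Cs : ℝ := d * (m * (stieltjesConst α T * Cσ * Real.Gamma (1 - α))) with hCs
  have hκ : 0 < β - α := by linarith
  have hCσ0 : 0 ≤ Cσ := by positivity
  have hA0 : 0 ≤ A := ENNReal.toReal_nonneg
  have hΓ : 0 < Real.Gamma (1 - α) := Real.Gamma_pos_of_pos h1α
  have hsc := stieltjesConst_nonneg hα hα1 hT.le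
  have hCs0 : 0 ≤ Cs := by positivity
  set C : ℝ := L 0 * T ^ α + A + Cs with hC
  have hC0 : 0 ≤ C := by positivity
  -- The summand `1` pays for the sup norm, as `N ≤ (1 + Λ)(1 + N)`; `(1 + d) * C` pays for the
  -- Hölder seminorm, `z` counting once and each of the `d` regulator coordinates once.
  refine ⟨1 + (1 + d) * C, by positivity, ?_⟩
  intro g η x hg _ hη hx
  have hw := hx.memW.2
  set N : ℝ := (wNorm α (-r) T x).toReal with hN
  set Λ : ℝ := (Lam α T g).toReal with hΛ
  have hN0 : 0 ≤ N := ENNReal.toReal_nonneg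
  have hΛ0 : 0 ≤ Λ := ENNReal.toReal_nonneg
  obtain ⟨z, y, hz, hy, hxzy⟩ := hx.equation
  set p : PathSpace d r T := ⟨(Icc (-r) T).domRestrict x, hx.cont.domRestrict⟩ with hp
  have hpN : ‖p‖ ≤ N := (ContinuousMap.norm_le _ hN0).2 fun u => norm_le_wNorm hw u.2
  have hF : ∀ i j, FracBounded α T (Cσ * (1 + N)) fun u => σ u (x (u - r)) (i, j) := fun i j =>
    diffusion_fracBounded hr.le hα hαβ hM.le hlip hhol hx.cont hw hN i j
  have hprod : (1 + Λ) * (1 + N) = 1 + Λ + N + Λ * N := by ring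
  have hΛN : 0 ≤ Λ * N := mul_nonneg hΛ0 hN0
  set H : ℝ := C * ((1 + Λ) * (1 + N)) with hH
  have hH0 : 0 ≤ H := by positivity
  have hzH : ∀ s t, 0 ≤ s → s ≤ t → t ≤ T → ‖z t - z s‖ ≤ H * (t - s) ^ (1 - α) := by
    intro s t hs hst ht
    have hdr := fun {s t : ℝ} (hs : 0 ≤ s) (hst : s ≤ t) (ht : t ≤ T) =>
      drift_integral_bound hb hα hα1.le hL0.le hb₀ hgrowth hpN hs hst ht
    have hst' := norm_stieltjesTo_sub_le hα hα1 hF hg hs hst ht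
    have hdr' := (hdr hs hst ht).2
    have hsplit := intervalIntegral.integral_add_adjacent_intervals
      (hdr le_rfl hs (hst.trans ht)).1 (hdr hs hst ht).1
    have e : z t - z s = (∫ u in s..t, b u p) +
        (stieltjesTo α T (fun u => σ u (x (u - r))) g t -
          stieltjesTo α T (fun u => σ u (x (u - r))) g s) := by
      rw [hz t ⟨hs.trans hst, ht⟩, hz s ⟨hs, hst.trans ht⟩, ← hsplit]
      abel
    have hR : 0 ≤ (t - s) ^ (1 - α) := Real.rpow_nonneg (by linarith) _
    rw [e]
    refine (norm_add_le _ _).trans ((add_le_add hdr' hst').trans ?_)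
    have e2 : (L 0 * N * T ^ α + A) * (t - s) ^ (1 - α) + d * (m * (stieltjesConst α T *
        (Cσ * (1 + N)) * (Real.Gamma (1 - α) * Λ) * (t - s) ^ (1 - α))) =
        (L 0 * T ^ α * N + A + Cs * (Λ * (1 + N))) * (t - s) ^ (1 - α) := by
      rw [hCs]
      ring
    rw [e2]
    refine mul_le_mul_of_nonneg_right ?_ hR
    rw [hH, hC, add_mul, add_mul]
    refine add_le_add (add_le_add ?_ ?_) ?_
    · exact mul_le_mul_of_nonneg_left (by linarith) (by positivity)
    · exact le_mul_of_one_le_right hA0 (by linarith)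
    · exact mul_le_mul_of_nonneg_left (by linarith) hCs0
  -- The equation is only given for `t > 0`. At `0` both integrals vanish, so `z 0 = η 0 ≥ 0` forces
  -- `y 0 = 0`.
  have hx0 : ∀ t ∈ Icc 0 T, x t = z t + y t := by
    intro t ht
    rcases ht.1.eq_or_lt with rfl | hpos
    · have hz0 : z 0 = η 0 := by
        rw [hz 0 ht, intervalIntegral.integral_same, stieltjesTo_zero]
        simp
      have hy0 : y 0 = 0 := by
        ext i
        obtain ⟨u, hu, huy⟩ := (hy 0 ht i).1
        obtain rfl : u = 0 := le_antisymm hu.2 hu.1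
        simp only [hz0] at huy
        rw [← huy]
        simpa using hη 0 ⟨by linarith, le_rfl⟩ i
      rw [hx.initial 0 ⟨by linarith, le_rfl⟩, hz0, hy0, add_zero]
    · exact hxzy t ⟨hpos, ht.2⟩
  have hholder : holderNorm (1 - α) 0 T x ≤
      ENNReal.ofReal N + ENNReal.ofReal ((1 + d) * H) :=
    holderNorm_le (fun u hu => norm_le_wNorm hw ⟨by linarith [hu.1], hu.2⟩)
      fun u v hu huv hv => norm_solution_sub_le h1α.le hH0 hzH hy hx0 hu huv.le hv
  refine ⟨⟨hx.cont.mono (Icc_subset_Icc_left (by linarith)), hholder.trans_lt (by simp)⟩, ?_⟩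
  -- Returning from real to extended values needs finiteness, since `toReal` sends `∞` to `0`.
  have hLam : Lam α T g = ENNReal.ofReal Λ :=
    (ENNReal.ofReal_toReal (hg.Lam_lt_top hα hα1).ne).symm
  have hW : wNorm α (-r) T x = ENNReal.ofReal N := (ENNReal.ofReal_toReal hw.ne).symm
  refine hholder.trans ?_
  rw [hLam, hW, ← ENNReal.ofReal_one, ← ENNReal.ofReal_add zero_le_one hΛ0,
    ← ENNReal.ofReal_add zero_le_one hN0, ← ENNReal.ofReal_mul (by positivity),
    ← ENNReal.ofReal_mul (by positivity), ← ENNReal.ofReal_add hN0 (by positivity)]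
  refine ENNReal.ofReal_le_ofReal ?_
  have e : (1 + (1 + (d : ℝ)) * C) * (1 + Λ) * (1 + N) =
      (1 + Λ) * (1 + N) + (1 + d) * H := by
    rw [hH]
    ring
  rw [e]
  linarith
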